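/- **Conventions.** All rings are commutative with $1$; complete topological rings are Hausdorff. An *f-adic ring* is a topological ring $A$ that has an open subring $A_0$ whose subspace topology is $I$-adic for some finitely generated ideal $I\subseteq A_0$. A *ring of integral elements* of $A$ is an open subring $A^+\subseteq A$ that is integrally closed in $A$ and consists of power-bounded elements; an *affinoid ring* is a pair $A=(A,A^+)$ of an f-adic ring and a ring of integral elements of it. $\operatorname{Spv}A$ is the set of equivalence classes of valuations on $A$ with the topology generated by the sets $\{v : v(f)\le v(s)\neq 0\}$, $f,s\in A$. $\operatorname{Spa}A$ is the subspace of those $v$ that are continuous (the set $\{a\in A : v(a)<\gamma\}$ is open for every $\gamma$ in the value group of $v$) and satisfy $v(f)\le 1$ for all $f\in A^+$. For $s\in A$ and a finite subset $T\subseteq A$ such that the ideal $T\cdot A$ is open, put $$R(\tfrac Ts)=\{v\in\operatorname{Spa}A : v(t)\le v(s)\neq 0\text{ for all }t\in T\};$$ these are the *rational subsets* of $\operatorname{Spa}A$. For such $(T,s)$ let $A(\tfrac Ts)$ be the localization $A_s$ with the ring topology for which the subgroups $\mathbb Z[\tfrac ts : t\in T]\cdot U$ ($U$ an open subgroup of $A$)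 form a fundamental system of neighbourhoods of $0$, and let $A(\tfrac Ts)^+$ be the integral closure of $A^+[\tfrac ts : t\in T]$ in $A_s$. Let $A\langle\tfrac Ts\rangle$ be the completion of $A(\tfrac Ts)$, equipped with the ring of integral elements $A\langle\tfrac Ts\rangle^+$ that is the closure of the image of $A(\tfrac Ts)^+$. Let $\rho\colon A\to A\langle\tfrac Ts\rangle$ be the canonical continuous homomorphism, and let $\operatorname{Spa}(\rho)\colon\operatorname{Spa}A\langle\tfrac Ts\rangle\to\operatorname{Spa}A$ be $v\mapsto v\circ\rho$. **Proposition (RationalFunction).** Let $A=(A,A^+)$ be an affinoid ring, let $s,s'\in A$, and let $T,T'\subseteq A$ be finite subsets such that $T\cdot A$ and $T'\cdot A$ are open in $A$. Let $\rho\colon A\to A\langle\tfrac Ts\rangle$ and $\rho'\colon A\to A\langle\tfrac{T'}{s'}\rangle$ be the canonical homomorphisms. 1. If $R(\tfrac{T'}{s'})\subseteq R(\tfrac Ts)$, then there is a unique continuous ring homomorphism $\sigma\colon A\langle\tfrac Ts\rangle\to A\langle\tfrac{T'}{s'}\rangle$ with $\sigma\circ\rho=\rho'$; moreover $\sigma$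 is a homomorphism of affinoid rings, i.e. $\sigma(A\langle\tfrac Ts\rangle^+)\subseteq A\langle\tfrac{T'}{s'}\rangle^+$. 2. The map $\operatorname{Spa}(\rho)$ is a homeomorphism of $\operatorname{Spa}A\langle\tfrac Ts\rangle$ onto $R(\tfrac Ts)$, and $V\mapsto\operatorname{Spa}(\rho)(V)$ is a bijection from the set of rational subsets of $\operatorname{Spa}A\langle\tfrac Ts\rangle$ onto the set of rational subsets of $\operatorname{Spa}A$ contained in $R(\tfrac Ts)$. -/

import Mathlib

namespace AdicSpectrum

open Topology Set

universe u

/-! ### f-adic rings and rings of integral elements -/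

/-- An *f-adic ring* (Huber ring): a topological ring containing an open subring `A₀` whose
subspace topology is `I`-adic for some finitely generated ideal `I` of `A₀`. -/
class FAdicRing (A : Type u) [CommRing A] [TopologicalSpace A] : Prop
    extends IsTopologicalRing A where
  exists_pair : ∃ A₀ : Subring A, IsOpen (A₀ : Set A) ∧ ∃ I : Ideal A₀, I.FG ∧ IsAdic I

/-- Bounded subsets of a topological ring. -/
def IsBoundedSubset {A : Type u} [CommRing A] [TopologicalSpace A] (B : Set A) : Prop :=
  ∀ U ∈ 𝓝 (0 : A), ∃ V ∈ 𝓝 (0 : A), ∀ v ∈ V, ∀ b ∈ B, v * b ∈ U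

/-- Power-bounded elements of a topological ring. -/
def IsPowerBounded {A : Type u} [CommRing A] [TopologicalSpace A] (a : A) : Prop :=
  IsBoundedSubset {x : A | ∃ n : ℕ, 1 ≤ n ∧ x = a ^ n}

/-- A *ring of integral elements* of `A`: an open subring, integrally closed in `A`, consisting of
power-bounded elements. An affinoid ring is an f-adic ring together with such a subring. -/
structure IsRingOfIntegralElements {A : Type u} [CommRing A] [TopologicalSpace A]
    (Aplus : Subring A) : Prop where
  isOpen : IsOpen (Aplus : Set A)
  integrallyClosed : ∀ a : A, IsIntegral Aplus a → a ∈ Aplus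
  powerBounded : ∀ a ∈ Aplus, IsPowerBounded a

/-! ### The valuation spectrum -/

/-- The valuation spectrum of `A`: the set of equivalence classes of valuations on `A`. A class is
given by the relation `v a ≤ v b` on `A`, which is Mathlib's `ValuativeRel`; see `Spv.mk`,
`Spv.exists_mk_eq` and `Spv.mk_eq_mk_iff` below. -/
def Spv (A : Type u) [CommRing A] : Type u := ValuativeRel A

namespace Spv

variable {A B C : Type u} [CommRing A] [CommRing B] [CommRing C]

/-- `v.le a b` means `v(a) ≤ v(b)`. -/
def le (v : Spv A) (a b : A) : Prop := ValuativeRel.vle (self := v) a b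

@[ext]
theorem ext {v w : Spv A} (h : ∀ a b, v.le a b ↔ w.le a b) : v = w :=
  ValuativeRel.ext (funext fun a => funext fun b => propext (h a b))

/-- The value group of `v` with a zero adjoined. -/
abbrev ValueGroup (v : Spv A) : Type u :=
  letI : ValuativeRel A := v
  ValuativeRel.ValueGroupWithZero A

noncomputable instance (v : Spv A) : LinearOrderedCommGroupWithZero v.ValueGroup :=
  letI : ValuativeRel A := v
  inferInstanceAs (LinearOrderedCommGroupWithZero (ValuativeRel.ValueGroupWithZero A))

/-- The canonical valuation in the class `v`; it takes values in the value group with zero. -/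
noncomputable def valuation (v : Spv A) : Valuation A v.ValueGroup :=
  letI : ValuativeRel A := v
  ValuativeRel.valuation A

theorem le_iff (v : Spv A) (a b : A) : v.le a b ↔ v.valuation a ≤ v.valuation b :=
  letI : ValuativeRel A := v
  Valuation.Compatible.vle_iff_le (v := ValuativeRel.valuation A) a b

/-- The class of a valuation. -/
def mk {Γ : Type*} [LinearOrderedCommGroupWithZero Γ] (v : Valuation A Γ) : Spv A :=
  ValuativeRel.ofValuation v

theorem mk_le {Γ : Type*} [LinearOrderedCommGroupWithZero Γ] (v : Valuation A Γ) (a b : A) :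
    (mk v).le a b ↔ v a ≤ v b := Iff.rfl

theorem mk_eq_mk_iff {Γ Γ' : Type*} [LinearOrderedCommGroupWithZero Γ]
    [LinearOrderedCommGroupWithZero Γ'] (v : Valuation A Γ) (w : Valuation A Γ') :
    mk v = mk w ↔ v.IsEquiv w := by
  constructor
  · intro h a b
    rw [← mk_le, ← mk_le, h]
  · intro h
    ext a b
    exact h a b

theorem exists_mk_eq (v : Spv A) : mk v.valuation = v := by
  ext a b
  rw [mk_le, le_iff]

/-- The map `Spv B → Spv A`, `v ↦ v ∘ φ`. -/
noncomputable def comap (φ : A →+* B) (v : Spv B) : Spv A := mk (v.valuation.comap φ)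

theorem comap_le (φ : A →+* B) (v : Spv B) (a b : A) :
    (comap φ v).le a b ↔ v.le (φ a) (φ b) := by
  rw [comap, mk_le, le_iff]
  rfl

/-- The topology generated by the sets `{v | v(f) ≤ v(s) ≠ 0}`. -/
instance : TopologicalSpace (Spv A) :=
  TopologicalSpace.generateFrom
    {W | ∃ f s : A, W = {v : Spv A | v.valuation f ≤ v.valuation s ∧ v.valuation s ≠ 0}}

/-- `v` is continuous if `{a | v(a) < γ}` is open for every `γ` in its value group. -/
def IsContinuous [TopologicalSpace A] (v : Spv A) : Prop :=
  ∀ γ : v.ValueGroup, γ ≠ 0 → IsOpen {a : A | v.valuation a < γ}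

end Spv

/-! ### The adic spectrum -/

/-- The adic spectrum of `(A, A⁺)`, with the subspace topology from `Spv A`. -/
def Spa (A : Type u) [CommRing A] [TopologicalSpace A] (Aplus : Subring A) : Type u :=
  {v : Spv A // v.IsContinuous ∧ ∀ f ∈ Aplus, v.valuation f ≤ 1}

instance (A : Type u) [CommRing A] [TopologicalSpace A] (Aplus : Subring A) :
    TopologicalSpace (Spa A Aplus) :=
  inferInstanceAs (TopologicalSpace {v : Spv A // v.IsContinuous ∧ ∀ f ∈ Aplus, v.valuation f ≤ 1})

/-- Data `(T, s)` defining a rational subset: `s ∈ A` and a finite `T ⊆ A` such that the ideal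
`T · A` is open. -/
structure RationalDatum (A : Type u) [CommRing A] [TopologicalSpace A] where
  T : Finset A
  s : A
  isOpen_span : IsOpen ((Ideal.span (T : Set A) : Ideal A) : Set A)

/-- The rational subset `R(T/s)` of `Spa A`. -/
def RationalDatum.R {A : Type u} [CommRing A] [TopologicalSpace A] (D : RationalDatum A)
    (Aplus : Subring A) : Set (Spa A Aplus) :=
  {x | (∀ t ∈ D.T, x.1.valuation t ≤ x.1.valuation D.s) ∧ x.1.valuation D.s ≠ 0}

/-- Rational subsets of `Spa A`. -/
def IsRationalSubset {A : Type u} [CommRing A] [TopologicalSpace A] {Aplus : Subring A}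
    (W : Set (Spa A Aplus)) : Prop :=
  ∃ D : RationalDatum A, W = D.R Aplus

theorem Spv.exists_valuation_div (A : Type u) [CommRing A] (v : Spv A) (γ : v.ValueGroup) :
    ∃ a b : A, v.valuation b ≠ 0 ∧ γ * v.valuation b = v.valuation a := by
  let _ : ValuativeRel A := v
  obtain ⟨a, b, h⟩ := ValuativeRel.exists_valuation_div_valuation_eq (R := A) γ
  refine ⟨a, b, ValuativeRel.valuation_posSubmonoid_ne_zero b, ?_⟩
  rw [← h]
  exact div_mul_cancel₀ _ (ValuativeRel.valuation_posSubmonoid_ne_zero b)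

theorem Spv.comap_valuation_lt {A B : Type u} [CommRing A] [CommRing B] (φ : A →+* B) (v : Spv B)
    (a b : A) : (Spv.comap φ v).valuation a < (Spv.comap φ v).valuation b ↔
      v.valuation (φ a) < v.valuation (φ b) := by
  rw [← not_le, ← not_le, ← Spv.le_iff, ← Spv.le_iff, Spv.comap_le]

theorem Spv.comap_valuation_le {A B : Type u} [CommRing A] [CommRing B] (φ : A →+* B) (v : Spv B)
    (a b : A) : (Spv.comap φ v).valuation a ≤ (Spv.comap φ v).valuation b ↔
      v.valuation (φ a) ≤ v.valuation (φ b) := by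
  rw [← Spv.le_iff, ← Spv.le_iff, Spv.comap_le]

theorem Spv.comap_valuation_ne_zero {A B : Type u} [CommRing A] [CommRing B] (φ : A →+* B)
    (v : Spv B) (a : A) : (Spv.comap φ v).valuation a ≠ 0 ↔ v.valuation (φ a) ≠ 0 := by
  have h := Spv.comap_valuation_lt φ v 0 a
  rwa [map_zero, map_zero, map_zero, zero_lt_iff, zero_lt_iff] at h

theorem Spv.IsContinuous.comap {A B : Type u} [CommRing A] [TopologicalSpace A] [CommRing B]
    [TopologicalSpace B] {φ : A →+* B} (hφ : Continuous φ) {v : Spv B} (hv : v.IsContinuous) :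
    (Spv.comap φ v).IsContinuous := by
  intro γ hγ
  obtain ⟨a, b, hb, h⟩ := Spv.exists_valuation_div A _ γ
  have ha : (Spv.comap φ v).valuation a ≠ 0 := by
    rw [← h]; exact mul_ne_zero hγ hb
  rw [Spv.comap_valuation_ne_zero] at ha hb
  convert (hv (v.valuation (φ a) / v.valuation (φ b)) (div_ne_zero ha hb)).preimage hφ using 1
  ext x
  have hb' : 0 < (Spv.comap φ v).valuation b := by
    rw [zero_lt_iff, Spv.comap_valuation_ne_zero]; exact hb
  rw [Set.mem_ofPred_eq, Set.mem_preimage, Set.mem_ofPred_eq, lt_div_iff₀ (zero_lt_iff.2 hb),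
    ← map_mul, ← map_mul, ← Spv.comap_valuation_lt, map_mul, ← h, mul_lt_mul_iff_left₀ hb']

/-- The map `Spa φ : Spa B → Spa A`, `v ↦ v ∘ φ`, induced by a continuous homomorphism
`φ : A → B` of affinoid rings. -/
noncomputable def Spa.map {A B : Type u} [CommRing A] [TopologicalSpace A] [CommRing B]
    [TopologicalSpace B] {Aplus : Subring A} {Bplus : Subring B} (φ : A →+* B)
    (hφ : Continuous φ) (hplus : ∀ a ∈ Aplus, φ a ∈ Bplus) (x : Spa B Bplus) : Spa A Aplus :=
  ⟨Spv.comap φ x.1, x.2.1.comap hφ, fun f hf => by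
    rw [← map_one (Spv.comap φ x.1).valuation, Spv.comap_valuation_le, map_one, map_one]
    exact x.2.2 _ (hplus f hf)⟩

/-! ### Topological localization -/

/-- `S · U`: the additive subgroup generated by the products `s * u` with `s ∈ S`, `u ∈ U`. -/
def mulSpan {R : Type u} [CommRing R] (S U : Set R) : AddSubgroup R :=
  AddSubgroup.closure {x | ∃ s ∈ S, ∃ u ∈ U, x = s * u}

section mulSpan

variable {R : Type u} [CommRing R] {S S' U U' : Set R}

theorem mul_mem_mulSpan {a b : R} (ha : a ∈ S) (hb : b ∈ U) : a * b ∈ mulSpan S U :=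
  AddSubgroup.subset_closure ⟨a, ha, b, hb, rfl⟩

theorem mulSpan_le {G : AddSubgroup R} (h : ∀ a ∈ S, ∀ b ∈ U, a * b ∈ G) : mulSpan S U ≤ G := by
  rw [mulSpan, AddSubgroup.closure_le]
  rintro _ ⟨a, ha, b, hb, rfl⟩
  exact h a ha b hb

theorem mulSpan_mono (hS : S ⊆ S') (hU : U ⊆ U') : mulSpan S U ≤ mulSpan S' U' :=
  mulSpan_le fun _ ha _ hb => mul_mem_mulSpan (hS ha) (hU hb)

/-- If `x * (s * u) ∈ G` for all `s ∈ S`, `u ∈ U`, then `x * y ∈ G` for all `y ∈ S · U`. -/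
theorem mul_mem_of_mem_mulSpan {G : AddSubgroup R} {x y : R}
    (h : ∀ a ∈ S, ∀ b ∈ U, x * (a * b) ∈ G) (hy : y ∈ mulSpan S U) : x * y ∈ G := by
  have : mulSpan S U ≤ G.comap (AddMonoidHom.mulLeft x) := mulSpan_le h
  exact this hy

end mulSpan

instance FAdicRing.nonarchimedeanRing {A : Type u} [CommRing A] [TopologicalSpace A]
    [FAdicRing A] : NonarchimedeanRing A where
  is_nonarchimedean := by
    intro W hW
    obtain ⟨A₀, hA₀, I, -, hI⟩ := FAdicRing.exists_pair (A := A)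
    have h0 : ((↑) : A₀ → A) ⁻¹' W ∈ 𝓝 (0 : A₀) :=
      continuous_subtype_val.continuousAt.preimage_mem_nhds (by simpa using hW)
    obtain ⟨n, -, hn⟩ := hI.hasBasis_nhds_zero.mem_iff.1 h0
    refine ⟨⟨(I ^ n).toAddSubgroup.map A₀.subtype.toAddMonoidHom, ?_⟩, ?_⟩
    · exact hA₀.isOpenMap_subtype_val _ ((isAdic_iff.1 hI).1 n)
    · rintro _ ⟨x, hx, rfl⟩
      exact hn hx

/-- If `T · A` is open in the f-adic ring `A`, then `T · U` is open for every open subgroup `U`. -/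
theorem isOpen_mulSpan {A : Type u} [CommRing A] [TopologicalSpace A] [FAdicRing A]
    (D : RationalDatum A) {U : AddSubgroup A} (hU : IsOpen (U : Set A)) :
    IsOpen (mulSpan (D.T : Set A) (U : Set A) : Set A) := by
  obtain ⟨A₀, hA₀, I, hfg, hI⟩ := FAdicRing.exists_pair (A := A)
  have hbasis (W : Set A) (hW : W ∈ 𝓝 (0 : A)) : ∃ n, ∀ x ∈ I ^ n, (x : A) ∈ W := by
    have h0 : ((↑) : A₀ → A) ⁻¹' W ∈ 𝓝 (0 : A₀) :=
      continuous_subtype_val.continuousAt.preimage_mem_nhds (by simpa using hW)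
    obtain ⟨n, -, hn⟩ := hI.hasBasis_nhds_zero.mem_iff.1 h0
    exact ⟨n, hn⟩
  obtain ⟨k, hk⟩ := hbasis _ (D.isOpen_span.mem_nhds (Ideal.zero_mem _))
  have hmul (l : A) (hl : l ∈ Ideal.span (D.T : Set A)) :
      ∀ a : A, ∃ m, ∀ x ∈ I ^ m, a * l * (x : A) ∈ mulSpan (D.T : Set A) (U : Set A) := by
    induction hl using Submodule.span_induction with
    | mem t ht =>
      intro a
      have hV : (fun y : A => a * y) ⁻¹' (U : Set A) ∈ 𝓝 (0 : A) :=
        (continuous_const_mul a).continuousAt.preimage_mem_nhds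
          (by rw [mul_zero]; exact hU.mem_nhds U.zero_mem)
      obtain ⟨m, hm⟩ := hbasis _ hV
      refine ⟨m, fun x hx => ?_⟩
      rw [mul_comm a t, mul_assoc]
      exact mul_mem_mulSpan ht (hm x hx)
    | zero => exact fun a => ⟨0, fun x _ => by rw [mul_zero, zero_mul]; exact zero_mem _⟩
    | add p q _ _ hp hq =>
      intro a
      obtain ⟨m, hm⟩ := hp a
      obtain ⟨n, hn⟩ := hq a
      refine ⟨m + n, fun x hx => ?_⟩
      rw [mul_add, add_mul]
      exact add_mem (hm x (Ideal.pow_le_pow_right (Nat.le_add_right m n) hx))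
        (hn x (Ideal.pow_le_pow_right (Nat.le_add_left n m) hx))
    | smul c p _ hp =>
      intro a
      obtain ⟨m, hm⟩ := hp (a * c)
      refine ⟨m, fun x hx => ?_⟩
      rw [smul_eq_mul, ← mul_assoc]
      exact hm x hx
  obtain ⟨L, hL⟩ := hfg.pow (n := k)
  have hLspan (l : A₀) (hl : l ∈ L) : (l : A) ∈ Ideal.span (D.T : Set A) :=
    hk l (hL ▸ Submodule.subset_span hl)
  have hmul' (l : A₀) : ∃ m, l ∈ L → ∀ x ∈ I ^ m,
      (l : A) * (x : A) ∈ mulSpan (D.T : Set A) (U : Set A) := by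
    by_cases hl : l ∈ L
    · obtain ⟨m, hm⟩ := hmul l (hLspan l hl) 1
      exact ⟨m, fun _ x hx => by simpa using hm x hx⟩
    · exact ⟨0, fun h => absurd h hl⟩
  choose m hm using hmul'
  have hprod (l : A₀) (hl : l ∈ I ^ k) : ∀ x ∈ I ^ (L.sup m),
      (l : A) * (x : A) ∈ mulSpan (D.T : Set A) (U : Set A) := by
    rw [← hL] at hl
    induction hl using Submodule.span_induction with
    | mem l hl => exact fun x hx => hm l hl x (Ideal.pow_le_pow_right (Finset.le_sup hl) hx)
    | zero => exact fun x _ => by rw [ZeroMemClass.coe_zero, zero_mul]; exact zero_mem _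
    | add p q _ _ hp hq =>
      intro x hx
      rw [Subring.coe_add, add_mul]
      exact add_mem (hp x hx) (hq x hx)
    | smul c p _ hp =>
      intro x hx
      have := hp (c * x) (Ideal.mul_mem_left _ c hx)
      rw [Subring.coe_mul] at this
      rw [smul_eq_mul, Subring.coe_mul]
      convert this using 1
      ring
  have hsub : (I ^ (k + L.sup m)).toAddSubgroup.map A₀.subtype.toAddMonoidHom ≤
      mulSpan (D.T : Set A) (U : Set A) := by
    rintro _ ⟨x, hx, rfl⟩
    have hx' : x ∈ I ^ k * I ^ (L.sup m) := by rw [← pow_add]; exact hx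
    clear hx
    induction hx' using Submodule.mul_induction_on' with
    | mem_mul_mem l hl y hy => exact hprod l hl y hy
    | add p _ q _ hp hq =>
      rw [map_add]
      exact add_mem hp hq
  exact AddSubgroup.isOpen_mono hsub (hA₀.isOpenMap_subtype_val _ ((isAdic_iff.1 hI).1 _))

/-- `T^n · U` (with `T^0 · U = U`). -/
def RationalDatum.powMulSpan {A : Type u} [CommRing A] [TopologicalSpace A]
    (D : RationalDatum A) (U : AddSubgroup A) : ℕ → AddSubgroup A
  | 0 => U
  | n + 1 => mulSpan (D.T : Set A) (D.powMulSpan U n : Set A)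

theorem RationalDatum.isOpen_powMulSpan {A : Type u} [CommRing A] [TopologicalSpace A]
    [FAdicRing A] (D : RationalDatum A) {U : AddSubgroup A} (hU : IsOpen (U : Set A)) (n : ℕ) :
    IsOpen (D.powMulSpan U n : Set A) := by
  induction n with
  | zero => exact hU
  | succ n ih => exact isOpen_mulSpan D ih

namespace RationalDatum

variable {A : Type u} [CommRing A] [TopologicalSpace A]

/-- The ring underlying `A(T/s)`: the localization `A_s`. -/
def Loc (D : RationalDatum A) : Type u := Localization.Away D.s

noncomputable instance (D : RationalDatum A) : CommRing D.Loc :=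
  inferInstanceAs (CommRing (Localization.Away D.s))

noncomputable instance (D : RationalDatum A) : Algebra A D.Loc :=
  inferInstanceAs (Algebra A (Localization.Away D.s))

instance (D : RationalDatum A) : IsLocalization.Away D.s D.Loc :=
  inferInstanceAs (IsLocalization.Away D.s (Localization.Away D.s))

/-- The fraction `t / s` in `A_s`. -/
noncomputable def frac (D : RationalDatum A) (t : A) : D.Loc :=
  algebraMap A D.Loc t * IsLocalization.Away.invSelf D.s

/-- The set `E = {t / s | t ∈ T}`. -/
def fracSet (D : RationalDatum A) : Set D.Loc := {x | ∃ t ∈ D.T, x = D.frac t}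

/-- The subgroup `ℤ[t/s | t ∈ T] · U` of `A_s`, for an open subgroup `U` of `A`. -/
noncomputable def nhdSubgroup (D : RationalDatum A) (U : OpenAddSubgroup A) : AddSubgroup D.Loc :=
  mulSpan (Subring.closure D.fracSet : Set D.Loc) (algebraMap A D.Loc '' (U : Set A))

theorem mul_mem_nhdSubgroup (D : RationalDatum A) (U : OpenAddSubgroup A) {d y : D.Loc}
    (hd : d ∈ Subring.closure D.fracSet) (hy : y ∈ D.nhdSubgroup U) : d * y ∈ D.nhdSubgroup U := by
  refine mul_mem_of_mem_mulSpan (fun e he u hu => ?_) hy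
  rw [← mul_assoc]
  exact mul_mem_mulSpan (mul_mem hd he) hu

theorem invSelf_pow_mul_mem (D : RationalDatum A) (U : OpenAddSubgroup A) (n : ℕ) {y : A}
    (hy : y ∈ D.powMulSpan (U : AddSubgroup A) n) :
    (IsLocalization.Away.invSelf D.s : D.Loc) ^ n * algebraMap A D.Loc y ∈ D.nhdSubgroup U := by
  induction n generalizing y with
  | zero =>
    rw [pow_zero]
    exact mul_mem_mulSpan (one_mem (Subring.closure D.fracSet)) (Set.mem_image_of_mem _ hy)
  | succ n ih =>
    have hle : D.powMulSpan (U : AddSubgroup A) (n + 1) ≤ (D.nhdSubgroup U).comap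
        ((AddMonoidHom.mulLeft ((IsLocalization.Away.invSelf D.s : D.Loc) ^ (n + 1))).comp
          (algebraMap A D.Loc).toAddMonoidHom) := by
      refine mulSpan_le fun t ht z hz => ?_
      have h := D.mul_mem_nhdSubgroup U
        (Subring.subset_closure (show D.frac t ∈ D.fracSet from ⟨t, ht, rfl⟩)) (ih hz)
      rw [AddSubgroup.mem_comap]
      convert h using 1
      change _ ^ (n + 1) * algebraMap A D.Loc (t * z) = D.frac t * _
      rw [frac, map_mul, pow_succ]
      ring
    exact hle hy

theorem ringSubgroupsBasis [FAdicRing A] (D : RationalDatum A) :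
    RingSubgroupsBasis D.nhdSubgroup := by
  refine RingSubgroupsBasis.of_comm _ (fun U V => ?_) (fun U => ?_) (fun x U => ?_)
  · exact ⟨U ⊓ V, le_inf (mulSpan_mono subset_rfl (Set.image_mono fun _ h => h.1))
      (mulSpan_mono subset_rfl (Set.image_mono fun _ h => h.2))⟩
  · obtain ⟨V, hV⟩ := NonarchimedeanRing.mul_subset U
    refine ⟨V, ?_⟩
    rintro _ ⟨x, hx, y, hy, rfl⟩
    refine mul_mem_of_mem_mulSpan ?_ hy
    rintro d hd _ ⟨v, hv, rfl⟩
    rw [mul_comm]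
    refine mul_mem_of_mem_mulSpan ?_ hx
    rintro e he _ ⟨w, hw, rfl⟩
    have := mul_mem_mulSpan (mul_mem hd he)
      (Set.mem_image_of_mem (algebraMap A D.Loc) (hV (Set.mul_mem_mul hv hw)))
    rw [map_mul] at this
    rw [mul_mul_mul_comm]
    exact this
  · obtain ⟨n, a, hx⟩ := IsLocalization.Away.surj D.s x
    have hs : algebraMap A D.Loc D.s * IsLocalization.Away.invSelf D.s = 1 :=
      IsLocalization.Away.mul_invSelf D.s
    have hx' : x = IsLocalization.Away.invSelf D.s ^ n * algebraMap A D.Loc a := by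
      rw [← hx, mul_left_comm, ← mul_pow, mul_comm (IsLocalization.Away.invSelf D.s), hs, one_pow,
        mul_one]
    let W : OpenAddSubgroup A := ⟨D.powMulSpan (U : AddSubgroup A) n, D.isOpen_powMulSpan U.isOpen n⟩
    refine ⟨W.comap (AddMonoidHom.mulLeft a) (continuous_const_mul a), fun y hy => ?_⟩
    refine mul_mem_of_mem_mulSpan ?_ hy
    rintro d hd _ ⟨v, hv, rfl⟩
    have h := D.mul_mem_nhdSubgroup U hd (D.invSelf_pow_mul_mem U n (y := a * v) hv)
    rw [map_mul, ← mul_assoc _ (algebraMap A D.Loc a), ← hx'] at h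
    rwa [mul_left_comm]

/-- The topology of `A(T/s)`: the subgroups `ℤ[t/s | t ∈ T] · U`, `U` an open subgroup of `A`, form
a fundamental system of neighbourhoods of `0`. -/
noncomputable instance [FAdicRing A] (D : RationalDatum A) : TopologicalSpace D.Loc :=
  D.ringSubgroupsBasis.topology

instance [FAdicRing A] (D : RationalDatum A) : NonarchimedeanRing D.Loc :=
  D.ringSubgroupsBasis.nonarchimedean

noncomputable instance [FAdicRing A] (D : RationalDatum A) : UniformSpace D.Loc :=
  IsTopologicalAddGroup.rightUniformSpace D.Loc

instance [FAdicRing A] (D : RationalDatum A) : IsUniformAddGroup D.Loc :=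
  isUniformAddGroup_of_addCommGroup

/-- The underlying topological ring of `A⟨T/s⟩`: the completion of `A(T/s)`. -/
abbrev Completed [FAdicRing A] (D : RationalDatum A) : Type u := UniformSpace.Completion D.Loc

/-- The ring of integral elements of `A(T/s)`: the integral closure of `A⁺[t/s | t ∈ T]` in
`A_s`. -/
noncomputable def locPlus (D : RationalDatum A) (Aplus : Subring A) : Subring D.Loc :=
  (integralClosure (Subring.closure (algebraMap A D.Loc '' (Aplus : Set A) ∪ D.fracSet) :
    Subring D.Loc) D.Loc).toSubring

/-- The ring of integral elements of `A⟨T/s⟩`: the completion of that of `A(T/s)`, i.e. the closure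
of its image. -/
noncomputable def plus [FAdicRing A] (D : RationalDatum A) (Aplus : Subring A) :
    Subring D.Completed :=
  ((D.locPlus Aplus).map UniformSpace.Completion.coeRingHom).topologicalClosure

/-- The canonical homomorphism `ρ : A → A⟨T/s⟩`. -/
noncomputable def rho [FAdicRing A] (D : RationalDatum A) : A →+* D.Completed :=
  UniformSpace.Completion.coeRingHom.comp (algebraMap A D.Loc)

theorem continuous_algebraMap [FAdicRing A] (D : RationalDatum A) :
    Continuous (algebraMap A D.Loc) := by
  refine continuous_of_continuousAt_zero (algebraMap A D.Loc) ?_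
  rw [ContinuousAt, map_zero, D.ringSubgroupsBasis.hasBasis_nhds_zero.tendsto_right_iff]
  intro U _
  filter_upwards [U.mem_nhds_zero] with u hu
  have := mul_mem_mulSpan (S := (Subring.closure D.fracSet : Set D.Loc))
    (one_mem (Subring.closure D.fracSet)) (Set.mem_image_of_mem (algebraMap A D.Loc) hu)
  rwa [one_mul] at this

theorem continuous_rho [FAdicRing A] (D : RationalDatum A) : Continuous D.rho :=
  UniformSpace.Completion.continuous_coeRingHom.comp D.continuous_algebraMap

theorem rho_mem_plus [FAdicRing A] (D : RationalDatum A) (Aplus : Subring A) :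
    ∀ a ∈ Aplus, D.rho a ∈ D.plus Aplus := by
  intro a ha
  refine Subring.le_topologicalClosure _ ⟨algebraMap A D.Loc a, ?_, rfl⟩
  exact (integralClosure (Subring.closure (algebraMap A D.Loc '' (Aplus : Set A) ∪ D.fracSet) :
    Subring D.Loc) D.Loc).algebraMap_mem
      ⟨_, Subring.subset_closure (Or.inl (Set.mem_image_of_mem _ ha))⟩

/-- The map `Spa ρ : Spa A⟨T/s⟩ → Spa A`. -/
noncomputable def spaRho [FAdicRing A] (D : RationalDatum A) (Aplus : Subring A) :
    Spa D.Completed (D.plus Aplus) → Spa A Aplus :=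
  Spa.map D.rho D.continuous_rho (D.rho_mem_plus Aplus)

end RationalDatum

end AdicSpectrum

/-! Part 1 rests on two facts about an f-adic ring with a ring of integral elements: an element with
`w(b) ≤ 1` at every point of `Spa` is integral (`mem_of_forall_le_one`), and, in the complete case,
an element vanishing at no point is a unit (`isUnit_of_forall_ne_zero`). Points of `Spa A⟨T'/s'⟩`
pull back into `R(T'/s') ⊆ R(T/s)`, so `ρ'(s)` is invertible and each `ρ'(t)/ρ'(s)` is integral,
hence power-bounded; the universal property of `A⟨T/s⟩` yields `σ`, and density of `A_s` yields
uniqueness. To prove the two facts, a bad element produces a valuation with no continuity beyond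
being `< 1` near `0`; specializing it along its characteristic subgroup makes it continuous.

For part 2, a point of `R(T/s)` extends to `A_s`, and by continuity to the completion, which gives
the image of `Spa ρ`. Topology and rational subsets are transported by perturbation: if `w(t) ≤ w(h)
≠ 0` for `t ∈ T` and `U` consists of topologically nilpotent elements, then `T · U` has values
strictly below `w(h)`, so changing elements by members of `T · U` does not affect comparisons with
`h`. When `T` generates an open ideal, `T · U` is a neighbourhood of `0`, so elements of the
completion may be replaced by elements of `A_s`, and then of `A` after clearing powers of `s`. No
quasi-compactness is needed.

The perturbations take place in the completion, so completed localizations must again be f-adic, and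
open ideals of `A` must generate open ideals there. The second point is a successive approximation
(`closure_image_mulSpan_subset`). -/

namespace AdicSpectrum

open Topology Set

universe u

/-! ### Bounded sets and power-bounded elements -/

section Bounded

variable {R : Type u} [CommRing R] [TopologicalSpace R]

theorem IsBoundedSubset.mono {B C : Set R} (hC : IsBoundedSubset C) (h : B ⊆ C) :
    IsBoundedSubset B := fun U hU =>
  let ⟨V, hV, hVU⟩ := hC U hU
  ⟨V, hV, fun v hv b hb => hVU v hv b (h hb)⟩

theorem IsBoundedSubset.singleton [IsTopologicalRing R] (a : R) :
    IsBoundedSubset ({a} : Set R) := by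
  intro U hU
  refine ⟨(fun x => x * a) ⁻¹' U, (continuous_mul_const a).continuousAt.preimage_mem_nhds
    (by rwa [zero_mul]), ?_⟩
  rintro v hv _ rfl
  exact hv

theorem IsBoundedSubset.union {B C : Set R} (hB : IsBoundedSubset B) (hC : IsBoundedSubset C) :
    IsBoundedSubset (B ∪ C) := by
  intro U hU
  obtain ⟨V, hV, h⟩ := hB U hU
  obtain ⟨W, hW, h'⟩ := hC U hU
  refine ⟨V ∩ W, Filter.inter_mem hV hW, ?_⟩
  rintro v ⟨hv, hw⟩ b (hb | hb)
  exacts [h v hv b hb, h' v hw b hb]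

theorem IsBoundedSubset.of_finite [IsTopologicalRing R] {B : Set R} (hB : B.Finite) :
    IsBoundedSubset B := by
  induction B, hB using Set.Finite.induction_on with
  | empty => exact fun U hU => ⟨U, hU, fun _ _ _ h => h.elim⟩
  | insert _ _ ih => exact (IsBoundedSubset.singleton _).union ih

theorem IsBoundedSubset.mul {B C : Set R} (hB : IsBoundedSubset B) (hC : IsBoundedSubset C) :
    IsBoundedSubset {x | ∃ b ∈ B, ∃ c ∈ C, x = b * c} := by
  intro U hU
  obtain ⟨V, hV, h⟩ := hC U hU
  obtain ⟨W, hW, h'⟩ := hB V hV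
  refine ⟨W, hW, ?_⟩
  rintro w hw _ ⟨b, hb, c, hc, rfl⟩
  rw [← mul_assoc]
  exact h _ (h' w hw b hb) c hc

theorem IsBoundedSubset.addSubgroupClosure [NonarchimedeanRing R] {B : Set R}
    (hB : IsBoundedSubset B) : IsBoundedSubset (AddSubgroup.closure B : Set R) := by
  intro U hU
  obtain ⟨O, hO⟩ := NonarchimedeanRing.is_nonarchimedean U hU
  obtain ⟨V, hV, h⟩ := hB O O.mem_nhds_zero
  refine ⟨V, hV, fun v hv b hb => hO ?_⟩
  have : AddSubgroup.closure B ≤ (O : AddSubgroup R).comap (AddMonoidHom.mulLeft v) :=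
    (AddSubgroup.closure_le _).2 fun b hb => h v hv b hb
  exact this hb

theorem IsBoundedSubset.mulSpan [NonarchimedeanRing R] {B C : Set R}
    (hB : IsBoundedSubset B) (hC : IsBoundedSubset C) :
    IsBoundedSubset (AdicSpectrum.mulSpan B C : Set R) :=
  (hB.mul hC).addSubgroupClosure

theorem IsPowerBounded.isBoundedSubset_powers [IsTopologicalRing R] {a : R}
    (ha : IsPowerBounded a) : IsBoundedSubset (Submonoid.powers a : Set R) := by
  refine (IsBoundedSubset.union (IsBoundedSubset.singleton (1 : R)) ha).mono ?_
  rintro _ ⟨n, rfl⟩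
  rcases Nat.eq_zero_or_pos n with rfl | hn
  · left; simp
  · right; exact ⟨n, hn, rfl⟩

theorem isPowerBounded_of_mem [IsTopologicalRing R] {S : Subring R}
    (hS : IsBoundedSubset (S : Set R)) {a : R} (ha : a ∈ S) : IsPowerBounded a :=
  hS.mono fun _ ⟨_, _, h⟩ => h ▸ pow_mem ha _

/-- Finitely many power-bounded elements generate a bounded subring. -/
theorem isBoundedSubset_subringClosure [NonarchimedeanRing R] {S : Set R} (hS : S.Finite)
    (h : ∀ a ∈ S, IsPowerBounded a) : IsBoundedSubset (Subring.closure S : Set R) := by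
  have key : IsBoundedSubset (Submonoid.closure S : Set R) := by
    induction S, hS using Set.Finite.induction_on with
    | empty =>
      rw [Submonoid.closure_empty]
      exact (IsBoundedSubset.singleton (1 : R)).mono (by simp)
    | insert _ _ ih =>
      rename_i a s _ _
      refine ((h a (mem_insert _ _)).isBoundedSubset_powers.mul
        (ih fun b hb => h b (mem_insert_of_mem _ hb))).mono ?_
      intro x hx
      rw [SetLike.mem_coe, Set.insert_eq, Submonoid.closure_union, Submonoid.mem_sup] at hx
      obtain ⟨y, hy, z, hz, rfl⟩ := hx
      refine ⟨y, ?_, z, hz, rfl⟩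
      rwa [Submonoid.powers_eq_closure]
  exact key.addSubgroupClosure.mono fun x hx => Subring.mem_closure_iff.1 hx

theorem IsPowerBounded.add [NonarchimedeanRing R] {a b : R} (ha : IsPowerBounded a)
    (hb : IsPowerBounded b) : IsPowerBounded (a + b) :=
  isPowerBounded_of_mem (isBoundedSubset_subringClosure (S := {a, b}) (Set.toFinite _)
    (by rintro c (rfl | rfl) <;> assumption))
    (add_mem (Subring.subset_closure (by simp)) (Subring.subset_closure (by simp)))

theorem isPowerBounded_of_mem_subringClosure [NonarchimedeanRing R] {S : Set R}
    (h : ∀ a ∈ S, IsPowerBounded a) {x : R} (hx : x ∈ Subring.closure S) : IsPowerBounded x := by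
  have hb {a b : R} (ha : IsPowerBounded a) (hb : IsPowerBounded b) :=
    isBoundedSubset_subringClosure (S := {a, b}) (Set.toFinite _)
      (by rintro c (rfl | rfl) <;> assumption)
  induction hx using Subring.closure_induction with
  | mem a ha => exact h a ha
  | zero =>
    exact isPowerBounded_of_mem (isBoundedSubset_subringClosure (S := ∅) (Set.toFinite _) (by simp))
      (zero_mem _)
  | one =>
    exact isPowerBounded_of_mem (isBoundedSubset_subringClosure (S := ∅) (Set.toFinite _) (by simp))
      (one_mem _)
  | add a b _ _ ha' hb' => exact ha'.add hb'
  | neg a _ ha =>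
    exact isPowerBounded_of_mem (hb ha ha) (neg_mem (Subring.subset_closure (by simp)))
  | mul a b _ _ ha' hb' =>
    exact isPowerBounded_of_mem (hb ha' hb')
      (mul_mem (Subring.subset_closure (by simp)) (Subring.subset_closure (by simp)))

open Polynomial in
-- The coefficients of an integral equation generate a bounded subring `K`, and all powers of `x`
-- lie in the span of finitely many of them over `K`.
theorem isPowerBounded_of_isIntegral [NonarchimedeanRing R] {S : Subring R}
    (hS : ∀ a ∈ S, IsPowerBounded a) {x : R} (hx : IsIntegral S x) : IsPowerBounded x := by
  obtain ⟨p, hp, hpx⟩ := hx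
  set n := p.natDegree
  set K : Set R := (fun i => (p.coeff i : R)) '' (Set.Iio n)
  have hK : IsBoundedSubset (Subring.closure K : Set R) :=
    isBoundedSubset_subringClosure ((Set.finite_Iio n).image _)
      (by rintro _ ⟨i, -, rfl⟩; exact hS _ (p.coeff i).2)
  -- The exponent `n` is included so that `1 ∈ E` even for `n = 0`; multiplying `x ^ n` by `x` is
  -- then handled by the integral equation.
  set E : Set R := (fun i => x ^ i) '' (Set.Iic n)
  have hE : IsBoundedSubset E := .of_finite ((Set.finite_Iic n).image _)
  have hxn : x ^ n = - ∑ i ∈ Finset.range n, (p.coeff i : R) * x ^ i := by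
    rw [hp.as_sum] at hpx
    simp only [eval₂_add, eval₂_pow, eval₂_X, eval₂_finsetSum, eval₂_mul, eval₂_C] at hpx
    exact eq_neg_of_add_eq_zero_left hpx
  have hmem : ∀ k, x ^ k ∈ mulSpan (Subring.closure K : Set R) E := by
    intro k
    induction k with
    | zero =>
      have := mul_mem_mulSpan (S := (Subring.closure K : Set R)) (U := E)
        (one_mem (Subring.closure K)) ⟨0, by simp, rfl⟩
      simpa using this
    | succ k ih =>
      rw [pow_succ']
      refine mul_mem_of_mem_mulSpan ?_ ih
      rintro c hc _ ⟨i, hi, rfl⟩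
      rcases (show i ≤ n from hi).lt_or_eq with hi | rfl
      · have := mul_mem_mulSpan (S := (Subring.closure K : Set R)) (U := E) hc
          ⟨i + 1, Nat.succ_le_of_lt hi, rfl⟩
        convert this using 1
        change x * (c * x ^ i) = c * x ^ (i + 1)
        ring
      · change x * (c * x ^ n) ∈ _
        rw [hxn, mul_neg, mul_neg, Finset.mul_sum, Finset.mul_sum]
        refine neg_mem (sum_mem fun i hi => ?_)
        have := mul_mem_mulSpan (S := (Subring.closure K : Set R)) (U := E)
          (mul_mem hc (Subring.subset_closure ⟨i, Finset.mem_range.1 hi, rfl⟩))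
          ⟨i + 1, Nat.succ_le_of_lt (Finset.mem_range.1 hi), rfl⟩
        convert this using 1
        change x * (c * (p.coeff i * x ^ i)) = c * p.coeff i * x ^ (i + 1)
        ring
  exact (hK.mulSpan hE).mono fun _ ⟨k, _, h⟩ => h ▸ hmem k

end Bounded

/-! ### Topologically nilpotent elements -/

section TopologicallyNilpotent

variable {R : Type u} [CommRing R] [TopologicalSpace R]

open Filter

theorem isTopologicallyNilpotent_mul [IsTopologicalRing R] {a b : R} (ha : IsPowerBounded a)
    (hb : IsTopologicallyNilpotent b) : IsTopologicallyNilpotent (a * b) := by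
  intro U hU
  obtain ⟨V, hV, h⟩ := ha.isBoundedSubset_powers U hU
  refine mem_map.2 ?_
  filter_upwards [hb.eventually hV] with n hn
  change (a * b) ^ n ∈ U
  rw [mul_pow, mul_comm]
  exact h _ hn _ ⟨n, rfl⟩

theorem isPowerBounded_of_isTopologicallyNilpotent [NonarchimedeanRing R] {a : R}
    (ha : IsTopologicallyNilpotent a) : IsPowerBounded a := by
  intro U hU
  obtain ⟨O, hO⟩ := NonarchimedeanRing.is_nonarchimedean U hU
  obtain ⟨V, hV⟩ := NonarchimedeanRing.mul_subset O
  obtain ⟨n, hn⟩ := eventually_atTop.1 (ha.eventually V.mem_nhds_zero)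
  obtain ⟨W, hW, h⟩ := IsBoundedSubset.of_finite ((Set.finite_Iio n).image fun i => a ^ i) O
    O.mem_nhds_zero
  refine ⟨V ∩ W, inter_mem V.mem_nhds_zero hW, ?_⟩
  rintro v ⟨hv, hw⟩ _ ⟨m, -, rfl⟩
  rcases lt_or_ge m n with hm | hm
  · exact hO (h v hw _ ⟨m, hm, rfl⟩)
  · exact hO (hV (Set.mul_mem_mul hv (hn m hm)))

/-- In each term of the binomial expansion of a high power one of the two exponents is large; the
other factor ranges over a bounded set. -/
theorem isTopologicallyNilpotent_add [NonarchimedeanRing R] {a b : R} (ha' : IsPowerBounded a)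
    (hb' : IsPowerBounded b) (ha : IsTopologicallyNilpotent a)
    (hb : IsTopologicallyNilpotent b) : IsTopologicallyNilpotent (a + b) := by
  intro U hU
  obtain ⟨O, hO⟩ := NonarchimedeanRing.is_nonarchimedean U hU
  obtain ⟨V, hV, h⟩ := ha'.isBoundedSubset_powers O O.mem_nhds_zero
  obtain ⟨W, hW, h'⟩ := hb'.isBoundedSubset_powers O O.mem_nhds_zero
  obtain ⟨n, hn⟩ := eventually_atTop.1 (hb.eventually hV)
  obtain ⟨m, hm⟩ := eventually_atTop.1 (ha.eventually hW)
  refine mem_map.2 (mem_of_superset (Ici_mem_atTop (n + m)) fun k hk => hO ?_)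
  rw [Set.mem_Ici] at hk
  change (a + b) ^ k ∈ (O : AddSubgroup R)
  rw [(Commute.all a b).add_pow']
  refine sum_mem fun ij hij => nsmul_mem ?_ _
  rw [Finset.HasAntidiagonal.mem_antidiagonal] at hij
  rcases le_or_gt m ij.1 with h1 | h1
  · exact h' _ (hm _ h1) _ ⟨_, rfl⟩
  · rw [mul_comm]
    exact h _ (hn _ (by omega)) _ ⟨_, rfl⟩

theorem isUnit_one_sub_of_isTopologicallyNilpotent {R : Type u} [CommRing R] [UniformSpace R]
    [IsUniformAddGroup R] [NonarchimedeanRing R] [CompleteSpace R] [T2Space R] {x : R}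
    (hx : IsTopologicallyNilpotent x) : IsUnit (1 - x) := by
  have : Summable fun n : ℕ => x ^ n := by
    apply NonarchimedeanAddGroup.summable_of_tendsto_cofinite_zero
    rw [Nat.cofinite_eq_atTop]
    exact hx
  exact IsUnit.of_mul_eq_one _ this.one_sub_mul_tsum_pow

/-- The topologically nilpotent elements of a subring consisting of power-bounded elements. -/
def topNilIdeal [NonarchimedeanRing R] (S : Subring R) (hS : ∀ a ∈ S, IsPowerBounded a) :
    Ideal S where
  carrier := {x | IsTopologicallyNilpotent (x : R)}
  zero_mem' := IsTopologicallyNilpotent.zero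
  add_mem' {a b} ha hb := isTopologicallyNilpotent_add (hS _ a.2) (hS _ b.2) ha hb
  smul_mem' c _ hx := isTopologicallyNilpotent_mul (hS _ c.2) hx

end TopologicallyNilpotent

/-! ### Making a valuation continuous by specialization -/

section Specialization

variable {R : Type u} [CommRing R] {Γ : Type*} [LinearOrderedCommGroupWithZero Γ]

open Classical in
/-- The primary specialization of `u` along its characteristic subgroup: the value `u x` is kept
if `u x` is at least the inverse of some value of `u`, and replaced by `0` otherwise. -/
noncomputable def characteristicSpecialization (u : Valuation R Γ) : Valuation R Γ where
  toFun x := if ∃ y, 1 ≤ u (x * y) then u x else 0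
  map_zero' := by simp
  map_one' := by rw [if_pos ⟨1, by simp⟩, map_one]
  map_mul' a b := by
    by_cases ha : ∃ y, 1 ≤ u (a * y)
    · by_cases hb : ∃ y, 1 ≤ u (b * y)
      · rw [if_pos ha, if_pos hb, if_pos, map_mul]
        obtain ⟨y, hy⟩ := ha
        obtain ⟨z, hz⟩ := hb
        refine ⟨y * z, ?_⟩
        rw [mul_mul_mul_comm, map_mul]
        exact one_le_mul hy hz
      · rw [if_neg hb, if_neg, mul_zero]
        rintro ⟨y, hy⟩
        exact hb ⟨a * y, by convert hy using 2; ring⟩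
    · rw [if_neg ha, if_neg, zero_mul]
      rintro ⟨y, hy⟩
      exact ha ⟨b * y, by convert hy using 2; ring⟩
  map_add_le_max' a b := by
    split_ifs with h ha hb hb
    · exact u.map_add a b
    -- Here `a` is kept and `b` is sent to `0`. If `u a < u b`, then `u (a + b) ≤ u b`, and the
    -- witness `y` for `a + b` would also keep `b`.
    · rw [max_eq_left zero_le]
      obtain ⟨y, hy⟩ := h
      refine (u.map_add a b).trans (max_le le_rfl (le_of_not_gt fun hab => hb ⟨y, ?_⟩))
      refine hy.trans ?_
      have h1 : u (a + b) ≤ u b := (u.map_add a b).trans (max_le hab.le le_rfl)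
      rw [map_mul, map_mul]
      gcongr
    · rw [max_eq_right zero_le]
      obtain ⟨y, hy⟩ := h
      refine (u.map_add a b).trans (max_le (le_of_not_gt fun hab => ha ⟨y, ?_⟩) le_rfl)
      refine hy.trans ?_
      have h1 : u (a + b) ≤ u a := (u.map_add a b).trans (max_le le_rfl hab.le)
      rw [map_mul, map_mul]
      gcongr
    · exfalso
      obtain ⟨y, hy⟩ := h
      rw [add_mul] at hy
      rcases le_max_iff.1 (hy.trans (u.map_add _ _)) with h | h
      exacts [ha ⟨y, h⟩, hb ⟨y, h⟩]
    all_goals exact zero_le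

open Classical in
theorem characteristicSpecialization_apply (u : Valuation R Γ) (x : R) :
    characteristicSpecialization u x = if ∃ y, 1 ≤ u (x * y) then u x else 0 := rfl

theorem characteristicSpecialization_le (u : Valuation R Γ) (x : R) :
    characteristicSpecialization u x ≤ u x := by
  rw [characteristicSpecialization_apply]
  split_ifs
  exacts [le_rfl, zero_le]

theorem characteristicSpecialization_of_one_le (u : Valuation R Γ) {x : R} (h : 1 ≤ u x) :
    characteristicSpecialization u x = u x := by
  rw [characteristicSpecialization_apply, if_pos ⟨1, by rwa [mul_one]⟩]

theorem Spv.mk_valuation_le {v : Valuation R Γ} (a b : R) :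
    (Spv.mk v).valuation a ≤ (Spv.mk v).valuation b ↔ v a ≤ v b := by
  rw [← Spv.le_iff, Spv.mk_le]

theorem Spv.mk_valuation_lt {v : Valuation R Γ} (a b : R) :
    (Spv.mk v).valuation a < (Spv.mk v).valuation b ↔ v a < v b := by
  rw [← not_le, ← not_le, Spv.mk_valuation_le]

theorem Spv.mk_valuation_eq_zero {v : Valuation R Γ} (a : R) :
    (Spv.mk v).valuation a = 0 ↔ v a = 0 := by
  have h := Spv.mk_valuation_le (v := v) a 0
  rwa [map_zero, map_zero, le_zero_iff, le_zero_iff] at h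

theorem Spv.mk_valuation_le_one {v : Valuation R Γ} (a : R) :
    (Spv.mk v).valuation a ≤ 1 ↔ v a ≤ 1 := by
  have h := Spv.mk_valuation_le (v := v) a 1
  rwa [map_one, map_one] at h

/-- Continuity of the class of a valuation, tested on the values of the valuation. -/
theorem Spv.isContinuous_mk [TopologicalSpace R] [IsTopologicalRing R] {v : Valuation R Γ}
    (h : ∀ a b, v a ≠ 0 → v b ≠ 0 → {x | v (x * b) < v a} ∈ 𝓝 (0 : R)) :
    (Spv.mk v).IsContinuous := by
  intro γ hγ
  obtain ⟨a, b, hb, hab⟩ := Spv.exists_valuation_div R _ γ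
  have ha : (Spv.mk v).valuation a ≠ 0 := by
    rw [← hab]; exact mul_ne_zero hγ hb
  have key := h a b (by rwa [Ne, ← Spv.mk_valuation_eq_zero])
    (by rwa [Ne, ← Spv.mk_valuation_eq_zero])
  refine AddSubgroup.isOpen_of_mem_nhds ((Spv.mk v).valuation.ltAddSubgroup (Units.mk0 γ hγ))
    (g := 0) (Filter.mem_of_superset key fun x hx => ?_)
  change (Spv.mk v).valuation x < γ
  rw [Set.mem_ofPred_eq, ← Spv.mk_valuation_lt, ← hab, map_mul] at hx
  exact lt_of_mul_lt_mul_right hx zero_le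

/-- A value `u a` survives only if `1 ≤ u (a * y)` for some `y`, so `u (x * b * y) < 1` already
forces `u (x * b) < u a`. The single neighbourhood `{u < 1}` therefore controls all surviving
values. -/
theorem isContinuous_characteristicSpecialization [TopologicalSpace R] [IsTopologicalRing R]
    {u : Valuation R Γ} (h : {x | u x < 1} ∈ 𝓝 (0 : R)) :
    (Spv.mk (characteristicSpecialization u)).IsContinuous := by
  refine Spv.isContinuous_mk fun a b ha _ => ?_
  have hex : ∃ y, 1 ≤ u (a * y) := by
    by_contra hne
    exact ha (by rw [characteristicSpecialization_apply, if_neg hne])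
  have hva : characteristicSpecialization u a = u a := by
    rw [characteristicSpecialization_apply, if_pos hex]
  obtain ⟨y, hy⟩ := hex
  filter_upwards [(continuous_mul_const (b * y)).continuousAt.preimage_mem_nhds
    (x := (0 : R)) (by rwa [zero_mul])] with x hx
  have hx : u (x * (b * y)) < 1 := hx
  rw [hva]
  refine (characteristicSpecialization_le u _).trans_lt ?_
  have := hx.trans_le hy
  rw [← mul_assoc, map_mul, map_mul u a] at this
  exact lt_of_mul_lt_mul_right this zero_le

/-- Specialization leaves values `≥ 1` unchanged and only lowers the others, so it preserves what
the two criteria below need: values exceeding `1`, and zeros. -/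
theorem exists_spa_of_valuation [TopologicalSpace R] [IsTopologicalRing R] {S : Subring R}
    {u : Valuation R Γ} (h : {x | u x < 1} ∈ 𝓝 (0 : R)) (hS : ∀ x ∈ S, u x ≤ 1) :
    ∃ w : Spa R S, (∀ x, 1 < u x → 1 < w.1.valuation x) ∧
      ∀ x, u x = 0 → w.1.valuation x = 0 := by
  refine ⟨⟨Spv.mk (characteristicSpecialization u), isContinuous_characteristicSpecialization h,
    fun f hf => ?_⟩, fun x hx => ?_, fun x hx => ?_⟩
  · rw [Spv.mk_valuation_le_one]
    exact (characteristicSpecialization_le u f).trans (hS f hf)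
  · rw [← not_le, Spv.mk_valuation_le_one, characteristicSpecialization_of_one_le u hx.le]
    exact hx.not_ge
  · rw [Spv.mk_valuation_eq_zero, ← le_zero_iff, ← hx]
    exact characteristicSpecialization_le u x

end Specialization

/-! ### Detecting integral elements and units on the adic spectrum -/

section Criteria

variable {R : Type u} [CommRing R]

/-- A subring `C` and a proper ideal of it are bounded, respectively contracted, by some valuation
on the ambient ring. -/
theorem exists_valuation_of_ideal_ne_top (C : Subring R) (J : Ideal C) (hJ : J ≠ ⊤) :
    ∃ (K : Type u) (_ : Field K) (V : ValuationSubring K) (f : R →+* K),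
      (∀ x ∈ C, V.valuation (f x) ≤ 1) ∧ ∀ x ∈ J, V.valuation (f x) < 1 := by
  obtain ⟨p, hp, hJp⟩ := J.exists_le_maximal hJ
  have hpp : p.IsPrime := hp.isPrime
  -- The prime `p` need not be contracted from `R`, but a minimal prime of a subring always is.
  -- Modulo a prime `Q` over `q ≤ p`, the image of `p` stays proper and is dominated by a valuation
  -- ring of `Frac (R ⧸ Q)`.
  obtain ⟨q, hq, hqp⟩ := Ideal.exists_minimalPrimes_le (I := (⊥ : Ideal C)) (J := p) bot_le
  have hq' : q ∈ (Ideal.comap C.subtype ⊥).minimalPrimes := by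
    convert hq using 2
    ext x
    simp
  obtain ⟨Q, hQp, -, hQq⟩ := Ideal.exists_comap_eq_of_mem_minimalPrimes C.subtype q hq'
  let K := FractionRing (R ⧸ Q)
  let f : R →+* K := (algebraMap (R ⧸ Q) K).comp (Ideal.Quotient.mk Q)
  have hf : ∀ x, f x = 0 ↔ x ∈ Q := fun x => by
    rw [← Ideal.Quotient.eq_zero_iff_mem,
      ← map_eq_zero_iff _ (IsFractionRing.injective (R ⧸ Q) K)]
    rfl
  let g : C →+* (C.map f) := (f.comp C.subtype).codRestrict (C.map f) fun x => ⟨x, x.2, rfl⟩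
  have hg : Function.Surjective g := by
    rintro ⟨_, x, hx, rfl⟩
    exact ⟨⟨x, hx⟩, rfl⟩
  have hker : ∀ x, g x = 0 → x ∈ p := fun x hx => hqp <| by
    rw [← hQq, Ideal.mem_comap, ← hf]
    exact congrArg Subtype.val hx
  have hne : p.map g ≠ ⊤ := by
    intro htop
    have h1 : (1 : C.map f) ∈ p.map g := htop ▸ Submodule.mem_top
    obtain ⟨x, hx, hx1⟩ := (Ideal.mem_map_iff_of_surjective g hg).1 h1
    refine hpp.ne_top ((Ideal.eq_top_iff_one p).2 ?_)
    have := hker (1 - x) (by rw [map_sub, map_one, hx1, sub_self])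
    simpa using add_mem this hx
  obtain ⟨V, hV, hV'⟩ := Ideal.image_subset_nonunits_valuationSubring _ hne
  refine ⟨K, inferInstance, V, f, fun x hx => ?_, fun x hx => ?_⟩
  · exact (V.valuation_le_one_iff _).2 (hV ⟨x, hx, rfl⟩)
  · exact hV' ⟨g x, Ideal.mem_map_of_mem g (hJp hx), rfl⟩

open Polynomial in
-- If `b` is not integral over `S`, then `1/b` is not a unit of `S[1/b]`, so some valuation is `≤ 1`
-- on `S` and `< 1` at `1/b`; it is then made continuous.
theorem exists_one_lt_of_notMem [TopologicalSpace R] [IsTopologicalRing R] {S : Subring R}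
    (hS : IsRingOfIntegralElements S) (hN : {x : R | IsTopologicallyNilpotent x} ∈ 𝓝 0)
    {b : R} (hb : b ∉ S) : ∃ w : Spa R S, 1 < w.1.valuation b := by
  have : Nontrivial S := by
    by_contra h
    rw [not_nontrivial_iff_subsingleton] at h
    have h10 : (1 : R) = 0 := congrArg Subtype.val (Subsingleton.elim (1 : S) 0)
    exact hb (by rw [← mul_one b, h10, mul_zero]; exact zero_mem S)
  let L := Localization.Away b
  let β : L := IsLocalization.Away.invSelf b
  have hβ : algebraMap R L b * β = 1 := IsLocalization.Away.mul_invSelf b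
  let _ : Invertible β := ⟨algebraMap R L b, hβ, by rw [mul_comm]; exact hβ⟩
  have hscalar : ∀ x : S, algebraMap S L x = algebraMap R L x := fun _ => rfl
  let J : Ideal (Algebra.adjoin S {β}) := Ideal.span {⟨β, Algebra.subset_adjoin rfl⟩}
  have hJ : J ≠ ⊤ := by
    intro htop
    obtain ⟨p, hp, hpβ⟩ := Algebra.exists_aeval_invOf_eq_zero_of_idealMap_adjoin_sup_span_eq_top β
      (⊥ : Ideal S) bot_ne_top (top_unique (htop.ge.trans le_sup_right))
    have hpm : p.Monic := sub_eq_zero.1 (by simpa using hp)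
    have h0 : algebraMap R L (aeval b p) = algebraMap R L 0 := by
      rw [map_zero, ← aeval_algebraMap_apply]
      exact hpβ
    -- The monic relation holds only in `R[1/b]`; in `R` it holds after multiplication by `b ^ k`,
    -- which keeps it monic.
    obtain ⟨⟨_, k, rfl⟩, hk⟩ := (IsLocalization.eq_iff_exists (Submonoid.powers b) L).1 h0
    refine hb (hS.integrallyClosed b ⟨X ^ k * p, (monic_X_pow k).mul hpm, ?_⟩)
    rw [← aeval_def, map_mul, map_pow, aeval_X]
    simpa using hk
  obtain ⟨K, _, V, f, hV, hV'⟩ :=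
    exists_valuation_of_ideal_ne_top (Algebra.adjoin S {β}).toSubring J hJ
  let u := V.valuation.comap (f.comp (algebraMap R L))
  have huS : ∀ x ∈ S, u x ≤ 1 := fun x hx =>
    hV _ ((Algebra.adjoin S {β}).algebraMap_mem ⟨x, hx⟩)
  have hub : 1 < u b := by
    have h1 : V.valuation (f β) < 1 := hV' ⟨β, Algebra.subset_adjoin rfl⟩ (Ideal.subset_span rfl)
    have h2 : u b * V.valuation (f β) = 1 := by
      change V.valuation (f (algebraMap R L b)) * _ = 1
      rw [← map_mul, ← map_mul, hβ, map_one, map_one]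
    by_contra hle
    exact absurd h2 ((mul_le_of_le_one_left zero_le (not_lt.1 hle)).trans_lt h1).ne
  -- For `x` topologically nilpotent, `x ^ n * b ∈ S` for some `n`, so `u x ^ n * u b ≤ 1`; as `u b
  -- > 1`, this forces `u x < 1`.
  have hunil : {x | u x < 1} ∈ 𝓝 (0 : R) := by
    filter_upwards [hN] with x hx
    have := ((continuous_mul_const b).continuousAt.tendsto.comp hx).eventually
      (by rw [zero_mul]; exact hS.isOpen.mem_nhds S.zero_mem)
    obtain ⟨n, hn⟩ := this.exists
    by_contra hle
    rw [not_lt] at hle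
    have h3 : u x ^ n * u b ≤ 1 := by
      rw [← map_pow, ← map_mul]
      exact huS _ hn
    exact h3.not_gt (hub.trans_le (le_mul_of_one_le_left zero_le (one_le_pow₀ hle)))
  obtain ⟨w, hw, -⟩ := exists_spa_of_valuation hunil huS
  exact ⟨w, hw b hub⟩

theorem mem_of_forall_le_one [TopologicalSpace R] [IsTopologicalRing R] {S : Subring R}
    (hS : IsRingOfIntegralElements S) (hN : {x : R | IsTopologicallyNilpotent x} ∈ 𝓝 0)
    {b : R} (hb : ∀ w : Spa R S, w.1.valuation b ≤ 1) : b ∈ S := by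
  by_contra h
  obtain ⟨w, hw⟩ := exists_one_lt_of_notMem hS hN h
  exact (hb w).not_gt hw

/-- A non-unit lies in a maximal ideal `m`. By completeness `1 - x` is a unit for `x` topologically
nilpotent, so the topologically nilpotent elements of `S` generate a proper ideal in the image of
`S` in `R ⧸ m`. A valuation on `R ⧸ m` that is `< 1` on that ideal gives a point at which `s`
vanishes. -/
theorem isUnit_of_forall_ne_zero [UniformSpace R] [IsUniformAddGroup R] [NonarchimedeanRing R]
    [CompleteSpace R] [T2Space R] {S : Subring R}
    (hS : IsRingOfIntegralElements S) (hN : {x : R | IsTopologicallyNilpotent x} ∈ 𝓝 0)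
    {s : R} (hs : ∀ w : Spa R S, w.1.valuation s ≠ 0) : IsUnit s := by
  by_contra hsu
  obtain ⟨m, hm, hsm⟩ := exists_max_ideal_of_mem_nonunits hsu
  let π := Ideal.Quotient.mk m
  let g : S →+* (S.map π) := (π.comp S.subtype).codRestrict (S.map π) fun x => ⟨x, x.2, rfl⟩
  have hg : Function.Surjective g := by
    rintro ⟨_, x, hx, rfl⟩
    exact ⟨⟨x, hx⟩, rfl⟩
  let J := topNilIdeal S hS.powerBounded
  have hJ : J.map g ≠ ⊤ := by
    intro htop
    have h1 : (1 : S.map π) ∈ J.map g := htop ▸ Submodule.mem_top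
    obtain ⟨x, hx, hx1⟩ := (Ideal.mem_map_iff_of_surjective g hg).1 h1
    have hmem : 1 - (x : R) ∈ m := by
      rw [← Ideal.Quotient.eq_zero_iff_mem, map_sub, map_one, sub_eq_zero]
      exact (congrArg Subtype.val hx1).symm
    exact hm.ne_top (m.eq_top_of_isUnit_mem hmem (isUnit_one_sub_of_isTopologicallyNilpotent hx))
  obtain ⟨K, _, V, f, hV, hV'⟩ := exists_valuation_of_ideal_ne_top (S.map π) (J.map g) hJ
  let u := V.valuation.comap (f.comp π)
  have huS : ∀ x ∈ S, u x ≤ 1 := fun x hx => hV _ ⟨x, hx, rfl⟩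
  have hunil : {x | u x < 1} ∈ 𝓝 (0 : R) := by
    filter_upwards [hN, hS.isOpen.mem_nhds S.zero_mem] with x hx hxS
    exact hV' (g ⟨x, hxS⟩) (Ideal.mem_map_of_mem g hx)
  obtain ⟨w, -, hw⟩ := exists_spa_of_valuation hunil huS
  refine hs w (hw s ?_)
  change V.valuation (f (π s)) = 0
  rw [Ideal.Quotient.eq_zero_iff_mem.2 hsm, map_zero, map_zero]

end Criteria

/-! ### Ideals of definition and open ideals -/

section FAdic

variable {A : Type u} [CommRing A] [TopologicalSpace A]

/-- The powers of an ideal of definition, as open subgroups of the ambient ring. -/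
def openPow [IsTopologicalRing A] {A₀ : Subring A} (hA₀ : IsOpen (A₀ : Set A)) {I : Ideal A₀}
    (hI : IsAdic I) (n : ℕ) : OpenAddSubgroup A where
  toAddSubgroup := (I ^ n).toAddSubgroup.map A₀.subtype.toAddMonoidHom
  isOpen' := hA₀.isOpenMap_subtype_val _ ((isAdic_iff.1 hI).1 n)

theorem exists_openPow_subset [IsTopologicalRing A] {A₀ : Subring A} (hA₀ : IsOpen (A₀ : Set A))
    {I : Ideal A₀} (hI : IsAdic I) {W : Set A} (hW : W ∈ 𝓝 0) :
    ∃ n, ∀ m ≥ n, (openPow hA₀ hI m : Set A) ⊆ W := by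
  have h0 : ((↑) : A₀ → A) ⁻¹' W ∈ 𝓝 (0 : A₀) :=
    continuous_subtype_val.continuousAt.preimage_mem_nhds (by simpa using hW)
  obtain ⟨n, hn⟩ := (isAdic_iff.1 hI).2 _ h0
  refine ⟨n, fun m hm => ?_⟩
  rintro _ ⟨x, hx, rfl⟩
  exact hn (Ideal.pow_le_pow_right hm hx)

theorem isOpen_span_of_ideal_pow [IsTopologicalRing A] {A₀ : Subring A}
    (hA₀ : IsOpen (A₀ : Set A)) {I : Ideal A₀} (hI : IsAdic I) {n : ℕ} {M : Set A₀}
    (hM : Ideal.span M = I ^ n) :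
    IsOpen ((Ideal.span (((↑) : A₀ → A) '' M) : Ideal A) : Set A) := by
  refine AddSubgroup.isOpen_mono (H₁ := openPow hA₀ hI n)
    (H₂ := (Ideal.span (((↑) : A₀ → A) '' M)).toAddSubgroup) ?_ (openPow hA₀ hI n).isOpen
  rintro _ ⟨x, hx, rfl⟩
  have : I ^ n ≤ (Ideal.span (((↑) : A₀ → A) '' M)).comap A₀.subtype := by
    rw [← hM, Ideal.span_le]
    exact fun m hm => Ideal.subset_span ⟨m, hm, rfl⟩
  exact this hx

/-- Every neighbourhood of `0` contains a finite set generating an open ideal. -/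
theorem exists_rationalDatum_subset [FAdicRing A] {N : Set A} (hN : N ∈ 𝓝 0) (s : A) :
    ∃ D : RationalDatum A, D.s = s ∧ (D.T : Set A) ⊆ N := by
  classical
  obtain ⟨A₀, hA₀, I, hfg, hI⟩ := FAdicRing.exists_pair (A := A)
  obtain ⟨n, hn⟩ := exists_openPow_subset hA₀ hI hN
  obtain ⟨L, hL⟩ := hfg.pow (n := n)
  refine ⟨⟨L.image (↑), s, ?_⟩, rfl, ?_⟩
  · rw [Finset.coe_image]
    exact isOpen_span_of_ideal_pow hA₀ hI hL
  · intro x hx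
    simp only [Finset.coe_image] at hx
    obtain ⟨y, hy, rfl⟩ := hx
    exact hn n le_rfl ⟨y, hL ▸ Submodule.subset_span hy, rfl⟩

theorem isTopologicallyNilpotent_mem_nhds_zero (A : Type u) [CommRing A] [TopologicalSpace A]
    [FAdicRing A] : {x : A | IsTopologicallyNilpotent x} ∈ 𝓝 0 := by
  obtain ⟨A₀, hA₀, I, -, hI⟩ := FAdicRing.exists_pair (A := A)
  refine Filter.mem_of_superset (openPow hA₀ hI 1).mem_nhds_zero ?_
  rintro _ ⟨x, hx, rfl⟩ W hW
  obtain ⟨n, hn⟩ := exists_openPow_subset hA₀ hI hW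
  refine Filter.mem_map.2 (Filter.mem_of_superset (Filter.Ici_mem_atTop n) fun m hm => ?_)
  exact hn m hm ⟨x ^ m, Ideal.pow_mem_pow (by simpa using hx) m, rfl⟩

theorem exists_sum_of_mem_mulSpan {A : Type u} [CommRing A] {T : Finset A} {W : AddSubgroup A}
    {x : A} (hx : x ∈ mulSpan (T : Set A) (W : Set A)) :
    ∃ y : A → A, (∀ t, y t ∈ W) ∧ x = ∑ t ∈ T, t * y t := by
  classical
  induction hx using AddSubgroup.closure_induction with
  | mem x hx =>
    obtain ⟨t, ht, w, hw, rfl⟩ := hx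
    refine ⟨fun r => if r = t then w else 0, fun r => ?_, ?_⟩
    · dsimp only
      split_ifs
      exacts [hw, zero_mem W]
    · simp [Finset.mem_coe.1 ht]
  | zero => exact ⟨0, fun _ => zero_mem W, by simp⟩
  | add a b _ _ ha hb =>
    obtain ⟨y, hy, rfl⟩ := ha
    obtain ⟨z, hz, rfl⟩ := hb
    exact ⟨y + z, fun t => add_mem (hy t) (hz t), by simp [mul_add, Finset.sum_add_distrib]⟩
  | neg a _ ha =>
    obtain ⟨y, hy, rfl⟩ := ha
    exact ⟨-y, fun t => neg_mem (hy t), by simp⟩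

end FAdic

/-! ### The completion of an f-adic ring is f-adic -/

section Completion

open UniformSpace

variable {R : Type u} [CommRing R] [UniformSpace R] [IsUniformAddGroup R]

theorem closure_image_coeRingHom_mem_nhds [IsTopologicalRing R] {V : Set R} (hV : V ∈ 𝓝 0) :
    closure ((Completion.coeRingHom : R →+* Completion R) '' V) ∈ 𝓝 0 := by
  rw [← map_zero (Completion.coeRingHom : R →+* Completion R)]
  exact Completion.isDenseInducing_coe.closure_image_mem_nhds hV

theorem exists_sub_mem_of_mem_closure {R : Type u} [AddCommGroup R] [TopologicalSpace R]
    [IsTopologicalAddGroup R] {S V : Set R} (hV : V ∈ 𝓝 0) {x : R} (hx : x ∈ closure S) :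
    ∃ a ∈ S, x - a ∈ V := by
  have : (fun y => x - y) ⁻¹' V ∈ 𝓝 x :=
    (continuous_sub_left x).continuousAt.preimage_mem_nhds (by rwa [sub_self])
  obtain ⟨a, ha, haS⟩ := mem_closure_iff_nhds.1 hx _ this
  exact ⟨a, haS, ha⟩

theorem exists_coe_sub_mem [IsTopologicalRing R] {V : Set (Completion R)} (hV : V ∈ 𝓝 0)
    (x : Completion R) : ∃ a : R, x - Completion.coeRingHom a ∈ V := by
  obtain ⟨_, ⟨a, rfl⟩, ha⟩ := exists_sub_mem_of_mem_closure hV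
    (Completion.denseRange_coe (α := R) x)
  exact ⟨a, ha⟩

/-- Successive approximation: `x` is a convergent sum of elements of `T · W j`, where the `W j ⊆ U`
shrink to `0`. Splitting each summand along the finite set `T` and summing the coefficients of each
`t` separately gives `x = ∑ t * (limit)` with limits in the closure of `U`. -/
theorem closure_image_mulSpan_subset [FAdicRing R] (D : RationalDatum R)
    (U : OpenAddSubgroup R) :
    closure ((Completion.coeRingHom : R →+* Completion R) ''
        (mulSpan (D.T : Set R) (U : Set R) : Set R)) ⊆
      (mulSpan ((Completion.coeRingHom : R →+* Completion R) '' (D.T : Set R))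
        (closure ((Completion.coeRingHom : R →+* Completion R) '' (U : Set R))) :
          Set (Completion R)) := by
  intro x hx
  set ι : R →+* Completion R := Completion.coeRingHom
  obtain ⟨A₀, hA₀, I, -, hI⟩ := FAdicRing.exists_pair (A := R)
  obtain ⟨W, hW0, hWU, hW⟩ : ∃ W : ℕ → OpenAddSubgroup R, W 0 = U ∧
      (∀ n, (W n : Set R) ⊆ U) ∧ ∀ V ∈ 𝓝 (0 : R), ∃ n, ∀ m ≥ n, (W m : Set R) ⊆ V := by
    -- The sequence starts at `U` itself because `x` is only known to lie in the closure of `T · U`.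
    refine ⟨fun n => Nat.casesOn n U fun n => openPow hA₀ hI n ⊓ U, rfl, fun n => ?_,
      fun V hV => ?_⟩
    · cases n
      exacts [subset_rfl, fun _ h => h.2]
    · obtain ⟨n, hn⟩ := exists_openPow_subset hA₀ hI hV
      refine ⟨n + 1, fun m hm => ?_⟩
      obtain ⟨k, rfl⟩ := Nat.exists_eq_add_of_le' (Nat.one_le_of_lt hm)
      exact fun y hy => hn k (by omega) hy.1
  obtain ⟨V, hVdef⟩ : ∃ V : ℕ → AddSubgroup R, ∀ n, V n = mulSpan (D.T : Set R) (W n : Set R) :=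
    ⟨_, fun _ => rfl⟩
  have hVo : ∀ n : ℕ, (V n : Set R) ∈ 𝓝 0 := fun n => by
    rw [hVdef]
    exact (isOpen_mulSpan D (W n).isOpen).mem_nhds (zero_mem _)
  have hV : ∀ O ∈ 𝓝 (0 : R), ∃ n : ℕ, ∀ m ≥ n, (V m : Set R) ⊆ O := by
    intro O hO
    obtain ⟨O', hO'⟩ := NonarchimedeanRing.is_nonarchimedean O hO
    have hmem : ⋂ t ∈ D.T, (fun y : R => t * y) ⁻¹' (O' : Set R) ∈ 𝓝 0 :=
      (Filter.biInter_finset_mem _).2 fun t _ =>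
        (continuous_const_mul t).continuousAt.preimage_mem_nhds
          (by rw [mul_zero]; exact O'.mem_nhds_zero)
    obtain ⟨n, hn⟩ := hW _ hmem
    refine ⟨n, fun m hm => Set.Subset.trans ?_ hO'⟩
    rw [hVdef]
    exact mulSpan_le (G := (O' : AddSubgroup R)) fun t ht y hy =>
      mem_iInter₂.1 (hn m hm hy) t ht
  have step : ∀ n (r : {r // r ∈ closure (ι '' (V n : Set R))}), ∃ g ∈ V n,
      (r : Completion R) - ι g ∈ closure (ι '' (V (n + 1) : Set R)) := by
    rintro n ⟨r, hr⟩
    obtain ⟨_, ⟨g, hg, rfl⟩, hg'⟩ := exists_sub_mem_of_mem_closure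
      (closure_image_coeRingHom_mem_nhds (hVo (n + 1))) hr
    exact ⟨g, hg, hg'⟩
  choose g hg hg' using step
  rw [← hW0, ← hVdef] at hx
  -- `f n` is the remainder after `n` steps of the approximation.
  obtain ⟨f, hf0, hf⟩ : ∃ f : ∀ n, {r // r ∈ closure (ι '' (V n : Set R))},
      (f 0).1 = x ∧ ∀ n, (f (n + 1)).1 = (f n).1 - ι (g n (f n)) :=
    ⟨fun n => Nat.rec ⟨x, hx⟩ (fun n r => ⟨r - ι (g n r), hg' n r⟩) n, rfl, fun _ => rfl⟩
  have hsum : ∀ n : ℕ, ∑ j ∈ Finset.range n, ι (g j (f j)) = x - (f n).1 := by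
    intro n
    induction n with
    | zero => rw [Finset.sum_range_zero, hf0, sub_self]
    | succ n ih => rw [Finset.sum_range_succ, ih, hf]; abel
  have hfz : Filter.Tendsto (fun n => (f n).1) Filter.atTop (𝓝 0) := by
    intro O hO
    obtain ⟨O', hO', hcl, hsub⟩ := exists_mem_nhds_isClosed_subset hO
    obtain ⟨n, hn⟩ := hV (ι ⁻¹' O')
      ((Completion.continuous_coe R).continuousAt.preimage_mem_nhds
        (by rwa [Completion.coe_zero]))
    refine Filter.mem_map.2 (Filter.mem_of_superset (Filter.Ici_mem_atTop n) fun m hm => hsub ?_)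
    exact closure_minimal (image_subset_iff.2 (hn m hm)) hcl (f m).2
  choose y hy hyg using fun j => exists_sum_of_mem_mulSpan
    (W := (W j : AddSubgroup R)) (hVdef j ▸ hg j (f j))
  have hsummable : ∀ t, Summable fun j => ι (y j t) := by
    intro t
    apply NonarchimedeanAddGroup.summable_of_tendsto_cofinite_zero
    rw [Nat.cofinite_eq_atTop]
    intro O hO
    obtain ⟨n, hn⟩ := hW (ι ⁻¹' O)
      ((Completion.continuous_coe R).continuousAt.preimage_mem_nhds
        (by rwa [Completion.coe_zero]))
    exact Filter.mem_map.2 (Filter.mem_of_superset (Filter.Ici_mem_atTop n)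
      fun m hm => hn m hm (hy m t))
  have hlim : x = ∑ t ∈ D.T, ι t * ∑' j, ι (y j t) := by
    have h1 : HasSum (fun j => ι (g j (f j))) (∑ t ∈ D.T, ι t * ∑' j, ι (y j t)) := by
      have := hasSum_sum fun t (_ : t ∈ D.T) => (hsummable t).hasSum.mul_left (ι t)
      have heq : (fun j => ι (g j (f j))) = fun j => ∑ t ∈ D.T, ι t * ι (y j t) := by
        funext j
        rw [hyg, map_sum]
        simp only [map_mul]
      rw [heq]
      exact this
    refine tendsto_nhds_unique ?_ h1.tendsto_sum_nat
    simp only [hsum]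
    simpa using hfz.const_sub x
  rw [hlim]
  refine sum_mem fun t ht => mul_mem_mulSpan ⟨t, ht, rfl⟩ ?_
  refine isClosed_closure.mem_of_tendsto (hsummable t).hasSum.tendsto_sum_nat
    (Filter.Eventually.of_forall fun n => subset_closure ?_)
  rw [← map_sum]
  exact ⟨_, AddSubgroup.sum_mem (U : AddSubgroup R) fun j _ => hWU j (hy j t), rfl⟩

theorem mulSpan_image_mem_nhds [FAdicRing R] (D : RationalDatum R) (U : OpenAddSubgroup R) :
    (mulSpan ((Completion.coeRingHom : R →+* Completion R) '' (D.T : Set R))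
        (closure ((Completion.coeRingHom : R →+* Completion R) '' (U : Set R))) :
          Set (Completion R)) ∈ 𝓝 0 :=
  Filter.mem_of_superset (closure_image_coeRingHom_mem_nhds
    ((isOpen_mulSpan D U.isOpen).mem_nhds (zero_mem _))) (closure_image_mulSpan_subset D U)

theorem isOpen_span_image_coeRingHom [FAdicRing R] (D : RationalDatum R) :
    IsOpen ((Ideal.span ((Completion.coeRingHom : R →+* Completion R) '' (D.T : Set R)) :
      Ideal (Completion R)) : Set (Completion R)) := by
  set J : Ideal (Completion R) :=
    Ideal.span ((Completion.coeRingHom : R →+* Completion R) '' (D.T : Set R))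
  refine AddSubgroup.isOpen_of_mem_nhds J.toAddSubgroup (g := 0)
    (Filter.mem_of_superset (mulSpan_image_mem_nhds D ⊤) ?_)
  exact mulSpan_le (G := J.toAddSubgroup) fun t ht x _ =>
    Ideal.mul_mem_right _ _ (Ideal.subset_span ht)

/-- The closure of `A₀`, with the ideal generated by `I`, is a pair of definition. Its powers are
open by `mulSpan_image_mem_nhds` applied to generators of `I ^ n`; they are small because the
closure of `I ^ n` is an ideal containing them. -/
theorem FAdicRing.completion [FAdicRing R] : FAdicRing (Completion R) where
  exists_pair := by
    classical
    set ι : R →+* Completion R := Completion.coeRingHom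
    obtain ⟨A₀, hA₀, I, hfg, hI⟩ := FAdicRing.exists_pair (A := R)
    let U₀ : OpenAddSubgroup R := ⟨A₀.toAddSubgroup, hA₀⟩
    let B₀ : Subring (Completion R) := (A₀.map ι).topologicalClosure
    let φ : A₀ →+* B₀ := (ι.comp A₀.subtype).codRestrict B₀ fun x =>
      Subring.le_topologicalClosure _ ⟨x, x.2, rfl⟩
    have hB₀ : (B₀ : Set (Completion R)) = closure (ι '' (A₀ : Set R)) := rfl
    refine ⟨B₀, AddSubgroup.isOpen_of_mem_nhds B₀.toAddSubgroup (g := 0)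
      (closure_image_coeRingHom_mem_nhds (hA₀.mem_nhds A₀.zero_mem)), I.map φ, hfg.map φ,
      isAdic_iff.2 ⟨fun n => ?_, fun s hs => ?_⟩⟩
    · obtain ⟨L, hL⟩ := hfg.pow (n := n)
      -- Only the finite generating set matters; the denominator `0` is a dummy.
      let D : RationalDatum R := ⟨L.image (↑), 0, by
        rw [Finset.coe_image]; exact isOpen_span_of_ideal_pow hA₀ hI hL⟩
      refine AddSubgroup.isOpen_of_mem_nhds (Submodule.toAddSubgroup _) (g := 0) ?_
      have h1 := continuous_subtype_val.continuousAt.preimage_mem_nhds (x := (0 : B₀))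
        (mulSpan_image_mem_nhds D U₀)
      refine Filter.mem_of_superset h1 fun x hx => ?_
      have h2 : mulSpan (ι '' (D.T : Set R)) (closure (ι '' (U₀ : Set R))) ≤
          ((I.map φ) ^ n).toAddSubgroup.map B₀.subtype.toAddMonoidHom := by
        refine mulSpan_le ?_
        rintro _ ⟨t, ht, rfl⟩ b hb
        simp only [D, Finset.coe_image] at ht
        obtain ⟨l, hl, rfl⟩ := ht
        refine ⟨φ l * ⟨b, hb⟩, Ideal.mul_mem_right _ _ ?_, rfl⟩
        rw [← Ideal.map_pow, ← hL]
        exact Ideal.mem_map_of_mem φ (Submodule.subset_span hl)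
      obtain ⟨z, hz, hzx⟩ := h2 hx
      rwa [← Subtype.ext hzx]
    · obtain ⟨O, hO, hOs⟩ := mem_nhds_subtype _ _ _ |>.1 hs
      obtain ⟨O', hO', hcl, hsub⟩ := exists_mem_nhds_isClosed_subset hO
      obtain ⟨n, hn⟩ := exists_openPow_subset hA₀ hI (W := ι ⁻¹' O')
        ((Completion.continuous_coe R).continuousAt.preimage_mem_nhds
          (by rwa [Completion.coe_zero]))
      refine ⟨n, fun x hx => hOs (hsub ?_)⟩
      refine closure_minimal (image_subset_iff.2 (hn n le_rfl)) hcl ?_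
      let K : Ideal B₀ :=
        { carrier := {x | (x : Completion R) ∈ closure (ι '' (openPow hA₀ hI n : Set R))}
          zero_mem' := subset_closure ⟨0, zero_mem (openPow hA₀ hI n), map_zero ι⟩
          add_mem' := fun {_ _} ha hb => AddSubgroup.add_mem
            ((openPow hA₀ hI n : AddSubgroup R).map ι.toAddMonoidHom).topologicalClosure ha hb
          smul_mem' := fun c x hx => map_mem_closure₂ continuous_mul c.2 hx (by
            rintro _ ⟨a, ha, rfl⟩ _ ⟨_, ⟨b, hb, rfl⟩, rfl⟩
            exact ⟨a * b, ⟨⟨a, ha⟩ * b, Ideal.mul_mem_left _ _ hb, rfl⟩, map_mul ι a b⟩) }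
      have hle : I ^ n ≤ K.comap φ := fun a ha => subset_closure ⟨a, ⟨a, ha, rfl⟩, rfl⟩
      rw [← Ideal.map_pow] at hx
      exact Ideal.map_le_iff_le_comap.2 hle hx

end Completion

attribute [local instance] FAdicRing.completion

/-! ### The completed ring of integral elements -/

section CompletionPlus

open UniformSpace

variable {R : Type u} [CommRing R] [UniformSpace R] [IsUniformAddGroup R]

theorem coeRingHom_mem_closure_image_iff [IsTopologicalRing R] {S : Set R} (hS : IsClosed S)
    {a : R} : (Completion.coeRingHom a : Completion R) ∈
      closure ((Completion.coeRingHom : R →+* Completion R) '' S) ↔ a ∈ S := by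
  have := (Completion.isUniformInducing_coe R).isInducing.closure_eq_preimage_closure_image S
  rw [hS.closure_eq] at this
  exact (Set.ext_iff.1 this a).symm

theorem coeRingHom_mem_topologicalClosure_iff [IsTopologicalRing R] {S : Subring R}
    (hS : IsOpen (S : Set R)) {a : R} :
    (Completion.coeRingHom a : Completion R) ∈
      (S.map (Completion.coeRingHom : R →+* Completion R)).topologicalClosure ↔ a ∈ S :=
  coeRingHom_mem_closure_image_iff (AddSubgroup.isClosed_of_isOpen S.toAddSubgroup hS)

theorem IsPowerBounded.coeRingHom [IsTopologicalRing R] {a : R} (ha : IsPowerBounded a) :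
    IsPowerBounded (Completion.coeRingHom a : Completion R) := by
  intro W hW
  obtain ⟨W', hW', hcl, hsub⟩ := exists_mem_nhds_isClosed_subset hW
  obtain ⟨V, hV, h⟩ := ha (Completion.coeRingHom ⁻¹' W')
    ((Completion.continuous_coe R).continuousAt.preimage_mem_nhds (by rwa [Completion.coe_zero]))
  refine ⟨_, closure_image_coeRingHom_mem_nhds hV, ?_⟩
  rintro v hv _ ⟨n, hn, rfl⟩
  refine hsub ?_
  have hc : IsClosed ((fun v : Completion R => v * Completion.coeRingHom a ^ n) ⁻¹' W') :=
    hcl.preimage (continuous_mul_const _)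
  refine closure_minimal ?_ hc hv
  rintro _ ⟨v, hv, rfl⟩
  change Completion.coeRingHom v * Completion.coeRingHom a ^ n ∈ W'
  rw [← map_pow, ← map_mul]
  exact h v hv _ ⟨n, hn, rfl⟩

open Polynomial in
-- The exponents are shifted by one so that the constant term has degree below the leading one even
-- when `n = 0`.
theorem isIntegral_of_pow_add_sum_mem {R : Type u} [CommRing R] {S : Subring R} {a : R} {n : ℕ}
    {b : ℕ → R}
    (hb : ∀ i, b i ∈ S)
    (h : a ^ (n + 1) + ∑ i ∈ Finset.range n, b i * a ^ (i + 1) ∈ S) : IsIntegral S a := by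
  set r : S := ⟨_, h⟩
  let q : S[X] := ∑ i ∈ Finset.range n, C ⟨b i, hb i⟩ * X ^ (i + 1) - C r
  have hq : q ∈ degreeLT S (n + 1) := by
    refine sub_mem (sum_mem fun i hi => ?_) ?_
    · rw [mem_degreeLT]
      refine (degree_C_mul_X_pow_le _ _).trans_lt ?_
      exact_mod_cast Nat.succ_lt_succ (Finset.mem_range.1 hi)
    · rw [mem_degreeLT]
      exact degree_C_le.trans_lt (by exact_mod_cast Nat.succ_pos n)
  refine ⟨X ^ (n + 1) + q, monic_X_pow_add (mem_degreeLT.1 hq), ?_⟩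
  simp only [q, eval₂_add, eval₂_sub, eval₂_pow, eval₂_X, eval₂_finsetSum, eval₂_mul, eval₂_C,
    ← add_sub_assoc]
  exact sub_self _

open Polynomial in
-- As `P` is open, an integral `x` may be moved by an element of `P` to some `a ∈ R`. Approximating
-- the coefficients of its equation by elements of `S` leaves an error in `P`; since `P ∩ R = S`,
-- this is an integral equation of `a` over `S`. Power-boundedness holds because elements of `P`
-- differ from elements of `S` by topologically nilpotent ones.
theorem IsRingOfIntegralElements.completion [FAdicRing R] {S : Subring R}
    (hS : IsRingOfIntegralElements S) : IsRingOfIntegralElements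
      (S.map (Completion.coeRingHom : R →+* Completion R)).topologicalClosure := by
  set ι : R →+* Completion R := Completion.coeRingHom
  set P := (S.map ι).topologicalClosure
  have hP : (P : Set (Completion R)) ∈ 𝓝 0 :=
    closure_image_coeRingHom_mem_nhds (hS.isOpen.mem_nhds S.zero_mem)
  refine ⟨AddSubgroup.isOpen_of_mem_nhds P.toAddSubgroup (g := 0) hP, fun x hx => ?_,
    fun q hq => ?_⟩
  · obtain ⟨a, ha⟩ := exists_coe_sub_mem hP x
    have hsub : x = ι a + (x - ι a) := by ring
    suffices a ∈ S by
      rw [hsub]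
      exact add_mem (Subring.le_topologicalClosure _ ⟨a, this, rfl⟩) ha
    have hint : IsIntegral P (ι a) := by
      have := hx.sub (isIntegral_algebraMap (R := P) (A := Completion R) (x := ⟨_, ha⟩))
      rw [show ι a = x - (x - ι a) from (sub_sub_cancel x (ι a)).symm]
      exact this
    obtain ⟨p, hp, hpa⟩ := hint
    rw [hp.as_sum] at hpa
    simp only [eval₂_add, eval₂_pow, eval₂_X, eval₂_finsetSum, eval₂_mul, eval₂_C] at hpa
    set n := p.natDegree
    have happrox : ∀ i, ∃ b ∈ S, ((p.coeff i : Completion R) - ι b) * ι a ^ (i + 1) ∈ P := by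
      intro i
      obtain ⟨_, ⟨b, hb, rfl⟩, h⟩ := exists_sub_mem_of_mem_closure
        (V := (fun y => y * ι a ^ (i + 1)) ⁻¹' (P : Set (Completion R)))
        ((continuous_mul_const _).continuousAt.preimage_mem_nhds (by rwa [zero_mul]))
        (p.coeff i).2
      exact ⟨b, hb, h⟩
    choose b hb hb' using happrox
    refine hS.integrallyClosed a (isIntegral_of_pow_add_sum_mem (n := n) hb ?_)
    rw [← coeRingHom_mem_topologicalClosure_iff hS.isOpen]
    have h0 : ι a ^ (n + 1) + ∑ i ∈ Finset.range n, (p.coeff i : Completion R) * ι a ^ (i + 1)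
        = 0 := by
      have := congrArg (fun y => y * ι a) hpa
      simp only [zero_mul, add_mul, Finset.sum_mul] at this
      rw [← this]
      simp only [pow_succ, mul_assoc]
      rfl
    have h1 : ι (a ^ (n + 1) + ∑ i ∈ Finset.range n, b i * a ^ (i + 1)) =
        -∑ i ∈ Finset.range n, ((p.coeff i : Completion R) - ι (b i)) * ι a ^ (i + 1) := by
      rw [map_add, map_sum, ← sub_eq_zero, ← h0]
      simp only [map_mul, map_pow, sub_mul, Finset.sum_sub_distrib]
      ring
    exact h1 ▸ neg_mem (sum_mem fun i _ => hb' i)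
  · obtain ⟨_, ⟨a, ha, rfl⟩, h⟩ := exists_sub_mem_of_mem_closure
      (isTopologicallyNilpotent_mem_nhds_zero (Completion R)) hq
    have := (hS.powerBounded a ha).coeRingHom.add (isPowerBounded_of_isTopologicallyNilpotent h)
    rwa [add_sub_cancel] at this

end CompletionPlus

/-! ### The localization `A(T/s)` and its completion as affinoid rings -/

namespace RationalDatum

variable {A : Type u} [CommRing A] [TopologicalSpace A] [FAdicRing A] (D : RationalDatum A)

theorem hasBasis_nhds_zero :
    (𝓝 (0 : D.Loc)).HasBasis (fun _ : OpenAddSubgroup A => True)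
      fun U => (D.nhdSubgroup U : Set D.Loc) :=
  D.ringSubgroupsBasis.hasBasis_nhds_zero

theorem nhdSubgroup_mem_nhds (U : OpenAddSubgroup A) : (D.nhdSubgroup U : Set D.Loc) ∈ 𝓝 0 :=
  D.hasBasis_nhds_zero.mem_of_mem trivial

/-- The ring of definition is `ℤ[t/s] · A₀`, and the `n`-th power of the ideal generated by `I` is
comparable with `ℤ[t/s] · I ^ n`. -/
theorem fAdicRing_loc : FAdicRing D.Loc where
  exists_pair := by
    obtain ⟨A₀, hA₀, I, hfg, hI⟩ := FAdicRing.exists_pair (A := A)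
    let ι := algebraMap A D.Loc
    let U₀ : OpenAddSubgroup A := ⟨A₀.toAddSubgroup, hA₀⟩
    have hmul : ∀ (U : OpenAddSubgroup A) (_ : ∀ a ∈ A₀, ∀ u ∈ U, a * u ∈ U) {x y : D.Loc},
        x ∈ D.nhdSubgroup U₀ → y ∈ D.nhdSubgroup U → x * y ∈ D.nhdSubgroup U := by
      intro U hU x y hx hy
      refine mul_mem_of_mem_mulSpan ?_ hy
      rintro d hd _ ⟨v, hv, rfl⟩
      rw [mul_comm]
      refine mul_mem_of_mem_mulSpan ?_ hx
      rintro e he _ ⟨w, hw, rfl⟩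
      have := mul_mem_mulSpan (mul_mem hd he)
        (Set.mem_image_of_mem (algebraMap A D.Loc) (hU w hw v hv))
      rw [map_mul, mul_comm (algebraMap A D.Loc w)] at this
      rw [mul_mul_mul_comm]
      exact this
    let B₀ : Subring D.Loc :=
      { D.nhdSubgroup U₀ with
        one_mem' := by
          have := mul_mem_mulSpan (one_mem (Subring.closure D.fracSet))
            (Set.mem_image_of_mem (algebraMap A D.Loc) (one_mem A₀))
          rwa [map_one, one_mul] at this
        mul_mem' := fun {x y} hx hy => hmul U₀ (fun a ha b hb => mul_mem (S := Subring A) ha hb)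
          hx hy }
    have hBι : ∀ a ∈ A₀, ι a ∈ B₀ := fun a ha => by
      have := mul_mem_mulSpan (one_mem (Subring.closure D.fracSet))
        (Set.mem_image_of_mem (algebraMap A D.Loc) ha)
      rwa [one_mul] at this
    have hBD : ∀ d ∈ Subring.closure D.fracSet, d ∈ B₀ := fun d hd => by
      have := mul_mem_mulSpan hd (Set.mem_image_of_mem (algebraMap A D.Loc) (one_mem A₀))
      rwa [map_one, mul_one] at this
    let φ : A₀ →+* B₀ := (ι.comp A₀.subtype).codRestrict B₀ fun x => hBι x x.2
    refine ⟨B₀, AddSubgroup.isOpen_of_mem_nhds (D.nhdSubgroup U₀) (g := 0)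
      (D.nhdSubgroup_mem_nhds U₀), I.map φ, hfg.map φ, isAdic_iff.2 ⟨fun n => ?_, fun s hs => ?_⟩⟩
    · refine AddSubgroup.isOpen_of_mem_nhds (Submodule.toAddSubgroup _) (g := 0) ?_
      have h1 := continuous_subtype_val.continuousAt.preimage_mem_nhds (x := (0 : B₀))
        (D.nhdSubgroup_mem_nhds (openPow hA₀ hI n))
      refine Filter.mem_of_superset h1 fun x hx => ?_
      have h2 : D.nhdSubgroup (openPow hA₀ hI n) ≤
          ((I.map φ) ^ n).toAddSubgroup.map B₀.subtype.toAddMonoidHom := by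
        refine mulSpan_le ?_
        rintro d hd _ ⟨_, ⟨a, ha, rfl⟩, rfl⟩
        refine ⟨⟨d, hBD d hd⟩ * φ a, Ideal.mul_mem_left _ _ ?_, rfl⟩
        rw [← Ideal.map_pow]
        exact Ideal.mem_map_of_mem φ ha
      obtain ⟨z, hz, hzx⟩ := h2 hx
      rwa [← Subtype.ext hzx]
    · obtain ⟨O, hO, hOs⟩ := mem_nhds_subtype _ _ _ |>.1 hs
      obtain ⟨U, -, hU⟩ := D.hasBasis_nhds_zero.mem_iff.1 hO
      obtain ⟨n, hn⟩ := exists_openPow_subset hA₀ hI U.mem_nhds_zero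
      refine ⟨n, fun x hx => hOs (hU ?_)⟩
      let K : Ideal B₀ :=
        { (D.nhdSubgroup (openPow hA₀ hI n)).comap B₀.subtype.toAddMonoidHom with
          smul_mem' := fun c x hx => hmul _ (by
            rintro a ha _ ⟨b, hb, rfl⟩
            exact ⟨⟨a, ha⟩ * b, Ideal.mul_mem_left _ _ hb, rfl⟩) c.2 hx }
      have hle : I ^ n ≤ K.comap φ := fun a ha => by
        have := mul_mem_mulSpan (one_mem (Subring.closure D.fracSet))
          (Set.mem_image_of_mem (algebraMap A D.Loc)
            (show (a : A) ∈ openPow hA₀ hI n from ⟨a, ha, rfl⟩))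
        rwa [one_mul] at this
      rw [← Ideal.map_pow] at hx
      have := Ideal.map_le_iff_le_comap.2 hle hx
      exact mulSpan_mono subset_rfl (Set.image_mono (hn n le_rfl)) this

attribute [local instance] fAdicRing_loc

theorem isOpen_span_image_algebraMap (E : RationalDatum A) :
    IsOpen ((Ideal.span (algebraMap A D.Loc '' (E.T : Set A)) : Ideal D.Loc) : Set D.Loc) := by
  set J : Ideal D.Loc := Ideal.span (algebraMap A D.Loc '' (E.T : Set A))
  let U : OpenAddSubgroup A := ⟨mulSpan (E.T : Set A) ((⊤ : AddSubgroup A) : Set A),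
    isOpen_mulSpan E isOpen_univ⟩
  refine AddSubgroup.isOpen_of_mem_nhds J.toAddSubgroup (g := 0)
    (Filter.mem_of_superset (D.nhdSubgroup_mem_nhds U) ?_)
  refine mulSpan_le (G := J.toAddSubgroup) ?_
  rintro d - _ ⟨x, hx, rfl⟩
  refine Ideal.mul_mem_left _ _ ?_
  have : mulSpan (E.T : Set A) ((⊤ : AddSubgroup A) : Set A) ≤
      J.toAddSubgroup.comap (algebraMap A D.Loc).toAddMonoidHom := by
    refine mulSpan_le fun t ht y _ => ?_
    change algebraMap A D.Loc (t * y) ∈ J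
    rw [map_mul]
    exact Ideal.mul_mem_right _ _ (Ideal.subset_span ⟨t, ht, rfl⟩)
  exact this hx

open Classical in
/-- The image of a datum under the canonical homomorphism to the completed localization. -/
noncomputable def mapRho (E : RationalDatum A) : RationalDatum D.Completed where
  T := E.T.image D.rho
  s := D.rho E.s
  isOpen_span := by
    let E' : RationalDatum D.Loc := ⟨E.T.image (algebraMap A D.Loc), 0, by
      rw [Finset.coe_image]; exact D.isOpen_span_image_algebraMap E⟩
    have := isOpen_span_image_coeRingHom E'
    rw [Finset.coe_image, Set.image_image] at this
    rw [Finset.coe_image]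
    exact this

theorem mem_mapRho_T {E : RationalDatum A} {x : D.Completed} :
    x ∈ (D.mapRho E).T ↔ ∃ t ∈ E.T, D.rho t = x := by
  classical
  exact Finset.mem_image

theorem isPowerBounded_frac {t : A} (ht : t ∈ D.T) : IsPowerBounded (D.frac t) := by
  intro W hW
  obtain ⟨U, -, hU⟩ := D.hasBasis_nhds_zero.mem_iff.1 hW
  refine ⟨_, D.nhdSubgroup_mem_nhds U, ?_⟩
  have hmem : D.frac t ∈ Subring.closure D.fracSet := Subring.subset_closure ⟨t, ht, rfl⟩
  rintro v hv _ ⟨n, -, rfl⟩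
  rw [mul_comm]
  exact hU (D.mul_mem_nhdSubgroup U (pow_mem hmem n) hv)

theorem isPowerBounded_algebraMap {a : A} (ha : IsPowerBounded a) :
    IsPowerBounded (algebraMap A D.Loc a) := by
  intro W hW
  obtain ⟨U, -, hU⟩ := D.hasBasis_nhds_zero.mem_iff.1 hW
  obtain ⟨V, hV, h⟩ := ha U U.mem_nhds_zero
  obtain ⟨V', hV'⟩ := NonarchimedeanRing.is_nonarchimedean V hV
  refine ⟨_, D.nhdSubgroup_mem_nhds V', ?_⟩
  rintro v hv _ ⟨n, hn, rfl⟩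
  rw [mul_comm]
  refine hU (mul_mem_of_mem_mulSpan ?_ hv)
  rintro d hd _ ⟨w, hw, rfl⟩
  rw [mul_left_comm, ← map_pow, ← map_mul, mul_comm _ w]
  exact mul_mem_mulSpan hd ⟨_, h w (hV' hw) _ ⟨n, hn, rfl⟩, rfl⟩

theorem isRingOfIntegralElements_locPlus {Aplus : Subring A}
    (hA : IsRingOfIntegralElements Aplus) : IsRingOfIntegralElements (D.locPlus Aplus) := by
  set C : Subring D.Loc := Subring.closure (algebraMap A D.Loc '' (Aplus : Set A) ∪ D.fracSet)
  have hC : ∀ x ∈ C, x ∈ D.locPlus Aplus := fun x hx =>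
    (integralClosure C D.Loc).algebraMap_mem ⟨x, hx⟩
  refine ⟨?_, fun x hx => ?_, fun x hx => ?_⟩
  · refine AddSubgroup.isOpen_of_mem_nhds (D.locPlus Aplus).toAddSubgroup (g := 0)
      (Filter.mem_of_superset (D.nhdSubgroup_mem_nhds ⟨Aplus.toAddSubgroup, hA.isOpen⟩) ?_)
    refine mulSpan_le (G := (D.locPlus Aplus).toAddSubgroup) ?_
    rintro d hd _ ⟨a, ha, rfl⟩
    exact hC _ (mul_mem (Subring.closure_mono subset_union_right hd)
      (Subring.subset_closure (Or.inl ⟨a, ha, rfl⟩)))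
  · exact isIntegral_trans (R := C) (A := integralClosure C D.Loc) x hx
  · refine isPowerBounded_of_isIntegral (S := C) (fun y hy => ?_) hx
    refine isPowerBounded_of_mem_subringClosure ?_ hy
    rintro _ (⟨a, ha, rfl⟩ | ⟨t, ht, rfl⟩)
    exacts [D.isPowerBounded_algebraMap (hA.powerBounded a ha), D.isPowerBounded_frac ht]

theorem isRingOfIntegralElements_plus {Aplus : Subring A}
    (hA : IsRingOfIntegralElements Aplus) : IsRingOfIntegralElements (D.plus Aplus) :=
  (D.isRingOfIntegralElements_locPlus hA).completion

end RationalDatum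

attribute [local instance] RationalDatum.fAdicRing_loc

/-! ### Extending continuous valuations to the completion -/

section ExtendValuation

open UniformSpace WithZeroTopology

variable {R : Type u} [CommRing R] [UniformSpace R] [IsUniformAddGroup R] [IsTopologicalRing R]

/-- Either some `a` with `v a ≠ 0` approximates `x` to within less than `v a`, and then `v` is
constant near `x` by the ultrametric inequality, or the values near `x` tend to `0`. -/
theorem exists_tendsto_of_isContinuous {v : Spv R} (hv : v.IsContinuous) (x : Completion R) :
    ∃ c, Filter.Tendsto v.valuation (Filter.comap ((↑) : R → Completion R) (𝓝 x)) (𝓝 c) := by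
  set ι : R →+* Completion R := Completion.coeRingHom
  have hcl : ∀ γ : v.ValueGroup, γ ≠ 0 → IsClosed {a | v.valuation a < γ} := fun γ hγ =>
    AddSubgroup.isClosed_of_isOpen (v.valuation.ltAddSubgroup (Units.mk0 γ hγ)) (hv γ hγ)
  let N : v.ValueGroup → Set (Completion R) := fun γ => closure (ι '' {a | v.valuation a < γ})
  have hN : ∀ γ, γ ≠ 0 → N γ ∈ 𝓝 0 := fun γ hγ => by
    refine closure_image_coeRingHom_mem_nhds ((hv γ hγ).mem_nhds ?_)
    rw [Set.mem_ofPred_eq, map_zero]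
    exact zero_lt_iff.2 hγ
  have hNev : ∀ γ, γ ≠ 0 → ∀ᶠ b in Filter.comap ((↑) : R → Completion R) (𝓝 x),
      x - ι b ∈ N γ := fun γ hγ =>
    Filter.preimage_mem_comap (m := ((↑) : R → Completion R)) <|
      show (fun y => x - y) ⁻¹' N γ ∈ 𝓝 x from
        (continuous_sub_left x).continuousAt.preimage_mem_nhds (by rw [sub_self]; exact hN γ hγ)
  by_cases h : ∃ a, v.valuation a ≠ 0 ∧ x - ι a ∈ N (v.valuation a)
  · obtain ⟨a, ha, hxa⟩ := h
    refine ⟨v.valuation a, (tendsto_of_ne_zero ha).2 ?_⟩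
    filter_upwards [hNev _ ha] with b hb
    refine Valuation.map_eq_of_sub_lt _ ?_
    have : ι (b - a) ∈ N (v.valuation a) := by
      have h1 := AddSubgroup.sub_mem (((v.valuation.ltAddSubgroup (Units.mk0 _ ha)).map
        ι.toAddMonoidHom).topologicalClosure) hxa hb
      rw [sub_sub_sub_cancel_left] at h1
      rw [map_sub]
      exact h1
    exact (coeRingHom_mem_closure_image_iff (hcl _ ha)).1 this
  · refine ⟨0, WithZeroTopology.tendsto_zero.2 fun γ hγ => ?_⟩
    filter_upwards [hNev γ hγ] with b hb
    by_contra hle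
    rw [not_lt] at hle
    refine h ⟨b, (zero_lt_iff.1 ((zero_lt_iff.2 hγ).trans_le hle)), ?_⟩
    exact closure_mono (Set.image_mono fun a ha => lt_of_lt_of_le ha hle) hb

theorem exists_extension_valuation {v : Spv R} (hv : v.IsContinuous) :
    ∃ w : Valuation (Completion R) v.ValueGroup, Continuous w ∧
      ∀ a : R, w (Completion.coeRingHom a) = v.valuation a := by
  have hlim := exists_tendsto_of_isContinuous hv
  set di : IsDenseInducing ((↑) : R → Completion R) := Completion.isDenseInducing_coe
  have hc : Continuous (di.extend v.valuation) := di.continuous_extend hlim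
  have he : ∀ a : R, di.extend v.valuation (a : Completion R) = v.valuation a :=
    di.extend_eq' hlim
  refine ⟨{ toFun := di.extend v.valuation, map_zero' := ?_, map_one' := ?_, map_mul' := ?_,
            map_add_le_max' := ?_ }, hc, he⟩
  · rw [← Completion.coe_zero, he, map_zero]
  · rw [← Completion.coe_one, he, map_one]
  · intro x y
    induction x, y using Completion.induction_on₂ with
    | hp =>
      exact isClosed_eq (hc.comp continuous_mul)
        ((hc.comp continuous_fst).mul (hc.comp continuous_snd))
    | ih a b => rw [← Completion.coe_mul, he, he, he, map_mul]
  · intro x y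
    change di.extend v.valuation (x + y) ≤
      max (di.extend v.valuation x) (di.extend v.valuation y)
    induction x, y using Completion.induction_on₂ with
    | hp =>
      exact isClosed_le (hc.comp continuous_add)
        ((hc.comp continuous_fst).max (hc.comp continuous_snd))
    | ih a b =>
      rw [← Completion.coe_add, he, he, he]
      exact v.valuation.map_add a b

theorem isContinuous_mk_of_continuous {R : Type u} [CommRing R] [TopologicalSpace R]
    [IsTopologicalRing R] {Γ : Type*} [LinearOrderedCommGroupWithZero Γ] {w : Valuation R Γ}
    (hw : Continuous w) : (Spv.mk w).IsContinuous := by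
  refine Spv.isContinuous_mk fun a b ha _ => ?_
  refine (WithZeroTopology.isOpen_Iio.preimage (hw.comp (continuous_mul_const b))).mem_nhds ?_
  change w (0 * b) < w a
  rw [zero_mul, map_zero]
  exact zero_lt_iff.2 ha

end ExtendValuation

/-! ### Valuations bounded by one on integral elements -/

section Integral

variable {R : Type u} [CommRing R] {Γ : Type*} [LinearOrderedCommGroupWithZero Γ]

theorem valuation_le_one_of_isIntegral (v : Valuation R Γ) {C : Subring R}
    (hC : ∀ c ∈ C, v c ≤ 1) {x : R} (hx : IsIntegral C x) : v x ≤ 1 := by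
  have hle : C ≤ v.integer := hC
  obtain ⟨p, hp, hpx⟩ := hx
  refine Valuation.Integers.mem_of_integral (Valuation.integer.integers v)
    ⟨p.map (Subring.inclusion hle), hp.map _, ?_⟩
  rw [Polynomial.eval₂_map]
  exact hpx

theorem valuation_le_one_of_mem_closure (v : Valuation R Γ) {S : Set R}
    (hS : ∀ c ∈ S, v c ≤ 1) {x : R} (hx : x ∈ Subring.closure S) : v x ≤ 1 :=
  (Subring.closure_le (t := v.integer)).2 hS hx

end Integral

/-! ### Topology of the adic spectrum -/

section Spa

variable {A : Type u} [CommRing A] [TopologicalSpace A]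

theorem Spa.topology_eq (Aplus : Subring A) :
    instTopologicalSpaceSpa A Aplus = TopologicalSpace.generateFrom
      {W | ∃ f g : A, W = {x : Spa A Aplus |
        x.1.valuation f ≤ x.1.valuation g ∧ x.1.valuation g ≠ 0}} := by
  refine Eq.trans (induced_generateFrom_eq (f := (Subtype.val : Spa A Aplus → Spv A))) ?_
  congr 1
  ext W
  constructor
  · rintro ⟨_, ⟨f, g, rfl⟩, rfl⟩
    exact ⟨f, g, rfl⟩
  · rintro ⟨f, g, rfl⟩
    exact ⟨_, ⟨f, g, rfl⟩, rfl⟩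

theorem isOpen_setOf_le (Aplus : Subring A) (f g : A) :
    IsOpen {x : Spa A Aplus | x.1.valuation f ≤ x.1.valuation g ∧ x.1.valuation g ≠ 0} := by
  have : IsOpen {v : Spv A | v.valuation f ≤ v.valuation g ∧ v.valuation g ≠ 0} :=
    TopologicalSpace.isOpen_generateFrom_of_mem ⟨f, g, rfl⟩
  exact this.preimage continuous_subtype_val

/-- Makes injectivity of `Spa ρ` a consequence of its being inducing. -/
instance Spa.t0Space (Aplus : Subring A) : T0Space (Spa A Aplus) where
  t0 := by
    intro x y h
    have key : ∀ f g, (x.1.valuation f ≤ x.1.valuation g ∧ x.1.valuation g ≠ 0) ↔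
        (y.1.valuation f ≤ y.1.valuation g ∧ y.1.valuation g ≠ 0) := fun f g =>
      h.mem_open_iff (isOpen_setOf_le Aplus f g)
    have hne : ∀ f, x.1.valuation f ≠ 0 ↔ y.1.valuation f ≠ 0 := fun f => by
      simpa using key f f
    refine Subtype.ext (Spv.ext fun f g => ?_)
    rw [Spv.le_iff, Spv.le_iff]
    by_cases hg : x.1.valuation g = 0
    · have hg' : y.1.valuation g = 0 := by simpa [hg] using hne g
      rw [hg, hg', le_zero_iff, le_zero_iff]
      exact not_iff_not.1 (hne f)
    · have := key f g
      rwa [and_iff_left hg, and_iff_left ((hne g).1 hg)] at this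

theorem Spa.valuation_lt_one [IsTopologicalRing A] {Aplus : Subring A} (w : Spa A Aplus) {a : A}
    (ha : IsTopologicallyNilpotent a) : w.1.valuation a < 1 := by
  obtain ⟨n, hn⟩ := (ha.eventually ((w.2.1 1 one_ne_zero).mem_nhds
    (by rw [Set.mem_ofPred_eq, map_zero]; exact zero_lt_one))).exists
  by_contra hle
  rw [not_lt] at hle
  have hn : w.1.valuation (a ^ n) < 1 := hn
  rw [map_pow] at hn
  exact hn.not_ge (one_le_pow₀ hle)

theorem Spa.continuous_map {B : Type u} [CommRing B] [TopologicalSpace B] {Aplus : Subring A}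
    {Bplus : Subring B} (φ : A →+* B) (hφ : Continuous φ) (hplus : ∀ a ∈ Aplus, φ a ∈ Bplus) :
    Continuous (Spa.map φ hφ hplus) := by
  rw [Spa.topology_eq Aplus]
  refine continuous_generateFrom_iff.2 ?_
  rintro _ ⟨f, g, rfl⟩
  convert isOpen_setOf_le Bplus (φ f) (φ g) using 1
  ext x
  exact and_congr (Spv.comap_valuation_le φ x.1 f g) (Spv.comap_valuation_ne_zero φ x.1 g)

end Spa

/-! ### The image of `Spa ρ` is `R(T/s)` -/

namespace RationalDatum

open UniformSpace
open scoped WithZeroTopology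

variable {A : Type u} [CommRing A] [TopologicalSpace A] [FAdicRing A] (D : RationalDatum A)
  {Aplus : Subring A}

theorem spaRho_le (w : Spa D.Completed (D.plus Aplus)) (f g : A) :
    (D.spaRho Aplus w).1.valuation f ≤ (D.spaRho Aplus w).1.valuation g ↔
      w.1.valuation (D.rho f) ≤ w.1.valuation (D.rho g) :=
  Spv.comap_valuation_le D.rho w.1 f g

theorem spaRho_ne_zero (w : Spa D.Completed (D.plus Aplus)) (f : A) :
    (D.spaRho Aplus w).1.valuation f ≠ 0 ↔ w.1.valuation (D.rho f) ≠ 0 :=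
  Spv.comap_valuation_ne_zero D.rho w.1 f

/-- The inverse of `ρ(s)`. -/
noncomputable def rhoInv : D.Completed := Completion.coeRingHom (IsLocalization.Away.invSelf D.s)

theorem rho_mul_rhoInv : D.rho D.s * D.rhoInv = 1 := by
  have : algebraMap A D.Loc D.s * IsLocalization.Away.invSelf D.s = 1 :=
    IsLocalization.Away.mul_invSelf D.s
  rw [rho, rhoInv, RingHom.comp_apply, ← map_mul, this, map_one]

theorem coe_frac (t : A) :
    (Completion.coeRingHom (D.frac t) : D.Completed) = D.rho t * D.rhoInv := by
  rw [frac, map_mul]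
  rfl

theorem coe_frac_mem_plus (Aplus : Subring A) {t : A} (ht : t ∈ D.T) :
    (Completion.coeRingHom (D.frac t) : D.Completed) ∈ D.plus Aplus := by
  refine Subring.le_topologicalClosure _ ⟨D.frac t, ?_, rfl⟩
  exact (integralClosure (Subring.closure (algebraMap A D.Loc '' (Aplus : Set A) ∪ D.fracSet) :
    Subring D.Loc) D.Loc).algebraMap_mem ⟨_, Subring.subset_closure (Or.inr ⟨t, ht, rfl⟩)⟩

theorem valuation_rho_ne_zero (w : Spa D.Completed (D.plus Aplus)) :
    w.1.valuation (D.rho D.s) ≠ 0 := by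
  intro h
  have := congrArg w.1.valuation D.rho_mul_rhoInv
  rw [map_mul, h, zero_mul, map_one] at this
  exact zero_ne_one this

theorem spaRho_mem_R (w : Spa D.Completed (D.plus Aplus)) : D.spaRho Aplus w ∈ D.R Aplus := by
  refine ⟨fun t ht => ?_, ?_⟩
  · rw [spaRho_le]
    have h1 := w.2.2 _ (D.coe_frac_mem_plus Aplus ht)
    have h2 : D.rho t = Completion.coeRingHom (D.frac t) * D.rho D.s := by
      rw [coe_frac, mul_assoc, mul_comm D.rhoInv, rho_mul_rhoInv, mul_one]
    rw [h2, map_mul]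
    exact mul_le_of_le_one_left zero_le h1
  · rw [spaRho_ne_zero]
    exact D.valuation_rho_ne_zero w

/-- Since `v s ≠ 0`, `v` extends to `A_s`. Since `v t ≤ v s`, the extension is `≤ 1` on `ℤ[t/s]`,
hence continuous for the topology with basis `ℤ[t/s] · U` and `≤ 1` on the integral closure; both
properties pass to the completion. -/
theorem exists_spaRho_eq {x : Spa A Aplus} (hx : x ∈ D.R Aplus) :
    ∃ w, D.spaRho Aplus w = x := by
  obtain ⟨hT, hs⟩ := hx
  set v := x.1.valuation
  have hS : Submonoid.powers D.s ≤ v.supp.primeCompl := by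
    rw [Submonoid.powers_le]
    exact hs
  let _ : IsLocalization (Submonoid.powers D.s) D.Loc :=
    inferInstanceAs (IsLocalization.Away D.s D.Loc)
  let u : Valuation D.Loc x.1.ValueGroup := v.extendToLocalization hS D.Loc
  have hu : ∀ a, u (algebraMap A D.Loc a) = v a :=
    v.extendToLocalization_apply_map_apply hS D.Loc
  have hfrac : ∀ f ∈ D.fracSet, u f ≤ 1 := by
    rintro _ ⟨t, ht, rfl⟩
    have h1 : D.frac t * algebraMap A D.Loc D.s = algebraMap A D.Loc t := by
      have : algebraMap A D.Loc D.s * IsLocalization.Away.invSelf D.s = 1 :=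
        IsLocalization.Away.mul_invSelf D.s
      rw [frac, mul_assoc, mul_comm _ (algebraMap A D.Loc D.s), this, mul_one]
    have h2 := congrArg u h1
    rw [map_mul, hu, hu] at h2
    refine le_of_mul_le_mul_right ?_ (zero_lt_iff.2 hs)
    rw [h2, one_mul]
    exact hT t ht
  have hucont : (Spv.mk u).IsContinuous := by
    refine Spv.isContinuous_mk fun a b ha hb => ?_
    let U : OpenAddSubgroup A :=
      ⟨v.ltAddSubgroup (Units.mk0 (u a / u b) (div_ne_zero ha hb)),
        x.2.1 _ (div_ne_zero ha hb)⟩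
    have hU : D.nhdSubgroup U ≤ u.ltAddSubgroup (Units.mk0 (u a / u b) (div_ne_zero ha hb)) := by
      refine mulSpan_le ?_
      rintro d hd _ ⟨y, hy, rfl⟩
      change u (d * algebraMap A D.Loc y) < u a / u b
      rw [map_mul, hu]
      exact (mul_le_of_le_one_left zero_le (valuation_le_one_of_mem_closure u hfrac hd)).trans_lt hy
    refine Filter.mem_of_superset (D.nhdSubgroup_mem_nhds U) fun y hy => ?_
    have h1 : u y < u a / u b := hU hy
    rw [lt_div_iff₀ (zero_lt_iff.2 hb)] at h1
    rw [Set.mem_ofPred_eq, map_mul]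
    exact h1
  have huplus : ∀ y ∈ D.locPlus Aplus, u y ≤ 1 := by
    intro y hy
    refine valuation_le_one_of_isIntegral u (fun c hc => ?_) hy
    refine valuation_le_one_of_mem_closure u ?_ hc
    rintro _ (⟨a, ha, rfl⟩ | hf)
    · rw [hu]
      exact x.2.2 a ha
    · exact hfrac _ hf
  obtain ⟨W, hW, hWu⟩ := exists_extension_valuation hucont
  have hWplus : ∀ b ∈ D.plus Aplus, W b ≤ 1 := by
    intro b hb
    refine closure_minimal ?_ (isClosed_Iic.preimage hW) hb
    rintro _ ⟨y, hy, rfl⟩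
    change W (Completion.coeRingHom y) ≤ 1
    rw [hWu, Spv.mk_valuation_le_one]
    exact huplus y hy
  refine ⟨⟨Spv.mk W, isContinuous_mk_of_continuous hW, fun f hf => ?_⟩, ?_⟩
  · rw [Spv.mk_valuation_le_one]
    exact hWplus f hf
  · refine Subtype.ext (Spv.ext fun a b => ?_)
    change (Spv.comap D.rho (Spv.mk W)).le a b ↔ _
    rw [Spv.comap_le, Spv.mk_le, rho, RingHom.comp_apply, RingHom.comp_apply, hWu, hWu,
      Spv.mk_valuation_le, hu, hu, Spv.le_iff]

theorem exists_mul_pow_eq_rho (a : D.Loc) : ∃ n, ∀ k ≥ n, ∃ f : A,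
    (Completion.coeRingHom a : D.Completed) * D.rho D.s ^ k = D.rho f := by
  obtain ⟨n, f, hf⟩ := IsLocalization.Away.surj D.s a
  refine ⟨n, fun k hk => ⟨f * D.s ^ (k - n), ?_⟩⟩
  rw [map_mul, map_pow, rho, RingHom.comp_apply, RingHom.comp_apply, ← hf, map_mul, map_pow,
    mul_assoc, ← pow_add, Nat.add_sub_cancel' hk]

end RationalDatum

/-! ### Perturbation by topologically nilpotent multiples -/

section Perturb

variable {B : Type u} [CommRing B] [TopologicalSpace B] [IsTopologicalRing B] {Bplus : Subring B}

/-- A continuous valuation is `< 1` on topologically nilpotent elements, and the ultrametric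
inequality handles sums. The bound is uniform in `w`: one neighbourhood `T · U` serves all points
with `T ≤ h`. -/
theorem valuation_lt_of_mem_mulSpan {w : Spa B Bplus} {T : Set B} {U : Set B}
    (hU : ∀ x ∈ U, IsTopologicallyNilpotent x) {h : B} (hh : w.1.valuation h ≠ 0)
    (hT : ∀ t ∈ T, w.1.valuation t ≤ w.1.valuation h) {x : B} (hx : x ∈ mulSpan T U) :
    w.1.valuation x < w.1.valuation h := by
  have : mulSpan T U ≤ w.1.valuation.ltAddSubgroup (Units.mk0 _ hh) := by
    refine mulSpan_le fun t ht y hy => ?_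
    change w.1.valuation (t * y) < w.1.valuation h
    rw [map_mul]
    calc w.1.valuation t * w.1.valuation y ≤ w.1.valuation h * w.1.valuation y := by
          gcongr; exact hT t ht
      _ < w.1.valuation h * 1 :=
          mul_lt_mul_of_pos_left (w.valuation_lt_one (hU y hy)) (zero_lt_iff.2 hh)
      _ = w.1.valuation h := mul_one _
  exact this hx

theorem exists_openAddSubgroup_isTopologicallyNilpotent (B : Type u) [CommRing B]
    [TopologicalSpace B] [FAdicRing B] :
    ∃ U : OpenAddSubgroup B, ∀ x ∈ (U : Set B), IsTopologicallyNilpotent x :=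
  let ⟨U, hU⟩ := NonarchimedeanRing.is_nonarchimedean _ (isTopologicallyNilpotent_mem_nhds_zero B)
  ⟨U, fun _ hx => hU hx⟩

end Perturb

/-! ### `Spa ρ` is an embedding -/

namespace RationalDatum

open UniformSpace

variable {A : Type u} [CommRing A] [TopologicalSpace A] [FAdicRing A] (D : RationalDatum A)
  {Aplus : Subring A}

theorem continuous_spaRho : Continuous (D.spaRho Aplus) :=
  Spa.continuous_map _ _ _

theorem valuation_mul_rho_pow_le (w : Spa D.Completed (D.plus Aplus)) (k : ℕ)
    (x y : D.Completed) : w.1.valuation (x * D.rho D.s ^ k) ≤ w.1.valuation (y * D.rho D.s ^ k) ↔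
      w.1.valuation x ≤ w.1.valuation y := by
  rw [map_mul, map_mul, map_pow]
  exact mul_le_mul_iff_left₀ (pow_pos (zero_lt_iff.2 (D.valuation_rho_ne_zero w)) k)

theorem valuation_mul_rho_pow_ne_zero (w : Spa D.Completed (D.plus Aplus)) (k : ℕ)
    (x : D.Completed) : w.1.valuation (x * D.rho D.s ^ k) ≠ 0 ↔ w.1.valuation x ≠ 0 := by
  rw [map_mul, map_pow]
  exact mul_ne_zero_iff_right (pow_ne_zero k (D.valuation_rho_ne_zero w))

/-- Near `w₀`, the condition `f ≤ g ≠ 0` is implied by conditions on approximations of `f` and `g`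
from `A_s`, together with the inequalities that keep the approximation errors below `g`. -/
theorem isInducing_spaRho : IsInducing (D.spaRho Aplus) := by
  refine ⟨le_antisymm D.continuous_spaRho.le_induced ?_⟩
  refine le_of_le_of_eq (le_generateFrom ?_) (Spa.topology_eq (D.plus Aplus)).symm
  rintro _ ⟨f, g, rfl⟩
  refine (@isOpen_iff_forall_mem_open _
    (TopologicalSpace.induced (D.spaRho Aplus) inferInstance) _).2 ?_
  rintro w₀ ⟨hfg, hg⟩
  obtain ⟨U, hU⟩ := exists_openAddSubgroup_isTopologicallyNilpotent D.Completed
  -- A finite set of elements of `A`, of value below `g` at `w₀`, generating an open ideal; again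
  -- the denominator `0` is a dummy.
  obtain ⟨E, -, hE⟩ := exists_rationalDatum_subset
    (N := D.rho ⁻¹' {x | w₀.1.valuation x < w₀.1.valuation g})
    (((w₀.2.1 _ hg).preimage D.continuous_rho).mem_nhds (by
      rw [Set.mem_preimage, map_zero, Set.mem_ofPred_eq, map_zero]
      exact zero_lt_iff.2 hg)) 0
  have hO := (isOpen_mulSpan (D.mapRho E) U.isOpen).mem_nhds (zero_mem _)
  have hT : ∀ w : Spa D.Completed (D.plus Aplus), ∀ h,
      (∀ t ∈ E.T, w.1.valuation (D.rho t) ≤ w.1.valuation h) →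
      ∀ t ∈ ((D.mapRho E).T : Set D.Completed), w.1.valuation t ≤ w.1.valuation h := by
    intro w h ht _ hx
    obtain ⟨t, ht', rfl⟩ := D.mem_mapRho_T.1 hx
    exact ht t ht'
  obtain ⟨a, ha⟩ := exists_coe_sub_mem hO f
  obtain ⟨b, hb⟩ := exists_coe_sub_mem hO g
  obtain ⟨m, hm⟩ := D.exists_mul_pow_eq_rho a
  obtain ⟨n, hn⟩ := D.exists_mul_pow_eq_rho b
  -- A common power of `s` clears both denominators; as `s` vanishes nowhere on `Spa A⟨T/s⟩`, no
  -- inequality changes.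
  obtain ⟨F, hF⟩ := hm (max m n) (le_max_left _ _)
  obtain ⟨G, hG⟩ := hn (max m n) (le_max_right _ _)
  set k := max m n
  let Q : Set (Spa A Aplus) :=
    {v | v.1.valuation F ≤ v.1.valuation G ∧ v.1.valuation G ≠ 0} ∩
      ⋂ t ∈ E.T, {v | v.1.valuation (t * D.s ^ k) ≤ v.1.valuation G ∧ v.1.valuation G ≠ 0}
  have hQ : ∀ w, D.spaRho Aplus w ∈ Q ↔
      (w.1.valuation (Completion.coeRingHom a) ≤ w.1.valuation (Completion.coeRingHom b) ∧
        w.1.valuation (Completion.coeRingHom b) ≠ 0) ∧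
      ∀ t ∈ E.T, w.1.valuation (D.rho t) ≤ w.1.valuation (Completion.coeRingHom b) ∧
        w.1.valuation (Completion.coeRingHom b) ≠ 0 := by
    intro w
    simp only [Q, Set.mem_inter_iff, Set.mem_iInter, Set.mem_ofPred_eq, spaRho_le,
      spaRho_ne_zero, ← hF, ← hG, map_mul D.rho, map_pow D.rho, valuation_mul_rho_pow_le,
      valuation_mul_rho_pow_ne_zero]
  refine ⟨D.spaRho Aplus ⁻¹' Q, fun w hw => ?_, isOpen_induced ?_, ?_⟩
  · obtain ⟨⟨hab, hb0⟩, ht⟩ := (hQ w).1 hw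
    have hlt : ∀ x ∈ mulSpan ((D.mapRho E).T : Set D.Completed) (U : Set D.Completed),
        w.1.valuation x < w.1.valuation (Completion.coeRingHom b) := fun x hx =>
      valuation_lt_of_mem_mulSpan hU hb0 (hT w _ fun t h => (ht t h).1) hx
    have hgb : w.1.valuation g = w.1.valuation (Completion.coeRingHom b) :=
      Valuation.map_eq_of_sub_lt _ (hlt _ hb)
    change w.1.valuation f ≤ w.1.valuation g ∧ w.1.valuation g ≠ 0
    rw [hgb]
    refine ⟨?_, hb0⟩
    rw [← sub_add_cancel f (Completion.coeRingHom a)]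
    exact (w.1.valuation.map_add _ _).trans (max_le (hlt _ ha).le hab)
  · refine (isOpen_setOf_le Aplus F G).inter ?_
    exact isOpen_biInter_finset fun t _ => isOpen_setOf_le Aplus _ G
  · have hle : ∀ t ∈ E.T, w₀.1.valuation (D.rho t) ≤ w₀.1.valuation g := fun t ht =>
      le_of_lt (hE ht)
    have hlt : ∀ x ∈ mulSpan ((D.mapRho E).T : Set D.Completed) (U : Set D.Completed),
        w₀.1.valuation x < w₀.1.valuation g := fun x hx =>
      valuation_lt_of_mem_mulSpan hU hg (hT w₀ _ hle) hx
    have hgb : w₀.1.valuation (Completion.coeRingHom b) = w₀.1.valuation g :=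
      Valuation.map_eq_of_sub_lt _ (by rw [Valuation.map_sub_swap]; exact hlt _ hb)
    rw [Set.mem_preimage, hQ, hgb]
    refine ⟨⟨?_, hg⟩, fun t ht => ⟨hle t ht, hg⟩⟩
    rw [← sub_sub_cancel f (Completion.coeRingHom a)]
    exact (w₀.1.valuation.map_sub _ _).trans (max_le hfg (hlt _ ha).le)

theorem isEmbedding_spaRho : IsEmbedding (D.spaRho Aplus) :=
  ⟨D.isInducing_spaRho, D.isInducing_spaRho.injective⟩

theorem range_spaRho : Set.range (D.spaRho Aplus) = D.R Aplus :=
  Set.Subset.antisymm (Set.range_subset_iff.2 D.spaRho_mem_R) fun _ hx => D.exists_spaRho_eq hx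

/-! ### Universal property and comparison of rational localizations -/

theorem ringHom_eqOn_range {S : Type u} [CommRing S] {σ τ : D.Completed →+* S}
    (h : σ.comp D.rho = τ.comp D.rho) (a : D.Loc) :
    σ (Completion.coeRingHom a) = τ (Completion.coeRingHom a) := by
  have : σ.comp Completion.coeRingHom = τ.comp Completion.coeRingHom :=
    IsLocalization.ringHom_ext (Submonoid.powers D.s) (by
      rw [RingHom.comp_assoc, RingHom.comp_assoc]; exact h)
  exact RingHom.congr_fun this a

theorem ringHom_ext {S : Type u} [CommRing S] [TopologicalSpace S] [T2Space S]
    {σ τ : D.Completed →+* S} (hσ : Continuous σ) (hτ : Continuous τ)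
    (h : σ.comp D.rho = τ.comp D.rho) : σ = τ := by
  refine RingHom.ext fun x => ?_
  induction x using Completion.induction_on with
  | hp => exact isClosed_eq hσ hτ
  | ih a => exact D.ringHom_eqOn_range h a

/-- The universal property of the completed localization. -/
theorem exists_continuous_lift {S : Type u} [CommRing S] [UniformSpace S] [IsUniformAddGroup S]
    [NonarchimedeanRing S] [CompleteSpace S] [T2Space S] 
    {f : A →+* S} (hf : Continuous f) {r : S} (hr : f D.s * r = 1)
    (hT : ∀ t ∈ D.T, IsPowerBounded (f t * r)) :
    ∃ σ : D.Completed →+* S, Continuous σ ∧ σ.comp D.rho = f := by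
  have hu : IsUnit (f D.s) := IsUnit.of_mul_eq_one _ hr
  let g : D.Loc →+* S := IsLocalization.Away.lift D.s hu
  have hg : ∀ a, g (algebraMap A D.Loc a) = f a := IsLocalization.Away.lift_eq D.s hu
  have hinv : g (IsLocalization.Away.invSelf D.s) = r := by
    have h1 : algebraMap A D.Loc D.s * IsLocalization.Away.invSelf D.s = 1 :=
      IsLocalization.Away.mul_invSelf D.s
    have h2 := congrArg g h1
    rw [map_mul, map_one, hg, ← hr] at h2
    exact hu.mul_left_cancel h2
  have hfrac : ∀ t, g (D.frac t) = f t * r := fun t => by rw [frac, map_mul, hg, hinv]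
  have hgc : Continuous g := by
    refine continuous_of_continuousAt_zero g ?_
    rw [ContinuousAt, map_zero]
    intro W hW
    obtain ⟨O, hO⟩ := NonarchimedeanRing.is_nonarchimedean W hW
    -- The image of `ℤ[t/s]` lies in a bounded subring, so `g` maps `ℤ[t/s] · U` into `O` once `f`
    -- maps `U` into a small enough subgroup.
    obtain ⟨V, hV, h⟩ := isBoundedSubset_subringClosure
      (S := (fun t => f t * r) '' (D.T : Set A)) (D.T.finite_toSet.image _)
      (by rintro _ ⟨t, ht, rfl⟩; exact hT t ht) O O.mem_nhds_zero
    obtain ⟨V', hV'⟩ := NonarchimedeanRing.is_nonarchimedean V hV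
    let U : OpenAddSubgroup A := V'.comap f.toAddMonoidHom hf
    refine Filter.mem_map.2 (Filter.mem_of_superset (D.nhdSubgroup_mem_nhds U)
      (Set.Subset.trans ?_ (Set.preimage_mono hO)))
    refine mulSpan_le (G := (O : AddSubgroup S).comap g.toAddMonoidHom) ?_
    rintro d hd _ ⟨y, hy, rfl⟩
    change g (d * algebraMap A D.Loc y) ∈ O
    rw [map_mul, hg, mul_comm]
    refine h _ (hV' hy) _ ?_
    have : Subring.closure D.fracSet ≤
        (Subring.closure ((fun t => f t * r) '' (D.T : Set A))).comap g := by
      rw [Subring.closure_le]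
      rintro _ ⟨t, ht, rfl⟩
      exact Subring.subset_closure ⟨t, ht, (hfrac t).symm⟩
    exact this hd
  refine ⟨Completion.extensionHom g hgc, Completion.continuous_extension, RingHom.ext fun a => ?_⟩
  rw [rho, RingHom.comp_apply, RingHom.comp_apply]
  exact (Completion.extensionHom_coe g hgc _).trans (hg a)

theorem map_mem_of_mem_plus {S : Type u} [CommRing S] [TopologicalSpace S] [IsTopologicalRing S]
    {f : A →+* S} {Splus : Subring S}
    (hS : IsRingOfIntegralElements Splus) (hf : ∀ a ∈ Aplus, f a ∈ Splus)
    {σ : D.Completed →+* S} (hσ : Continuous σ) (hσf : σ.comp D.rho = f)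
    (hT : ∀ t ∈ D.T, σ (Completion.coeRingHom (D.frac t)) ∈ Splus) :
    ∀ b ∈ D.plus Aplus, σ b ∈ Splus := by
  intro b hb
  have hcl : IsClosed (Splus : Set S) :=
    AddSubgroup.isClosed_of_isOpen Splus.toAddSubgroup hS.isOpen
  refine closure_minimal ?_ (hcl.preimage hσ) hb
  rintro _ ⟨y, hy, rfl⟩
  let g : D.Loc →+* S := σ.comp Completion.coeRingHom
  set C : Subring D.Loc := Subring.closure (algebraMap A D.Loc '' (Aplus : Set A) ∪ D.fracSet)
  have hC : ∀ c ∈ C, g c ∈ Splus := by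
    have : C ≤ Splus.comap g := by
      rw [Subring.closure_le]
      rintro _ (⟨a, ha, rfl⟩ | ⟨t, ht, rfl⟩)
      · have := hf a ha
        rwa [← hσf] at this
      · exact hT t ht
    exact this
  refine hS.integrallyClosed _ ?_
  obtain ⟨p, hp, hpy⟩ := (hy : IsIntegral C y)
  refine ⟨p.map ((g.comp C.subtype).codRestrict Splus fun c => hC c c.2), hp.map _, ?_⟩
  rw [Polynomial.eval₂_map]
  have := congrArg g hpy
  rw [map_zero, Polynomial.hom_eval₂] at this
  exact this

theorem rational_restriction (hA : IsRingOfIntegralElements Aplus) {D' : RationalDatum A}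
    (hsub : D'.R Aplus ⊆ D.R Aplus) :
    (∃! σ : D.Completed →+* D'.Completed, Continuous σ ∧ σ.comp D.rho = D'.rho) ∧
      ∀ σ : D.Completed →+* D'.Completed, Continuous σ → σ.comp D.rho = D'.rho →
        ∀ b ∈ D.plus Aplus, σ b ∈ D'.plus Aplus := by
  have hplus := D'.isRingOfIntegralElements_plus hA
  have hnil := isTopologicallyNilpotent_mem_nhds_zero D'.Completed
  have hR : ∀ w : Spa D'.Completed (D'.plus Aplus),
      (∀ t ∈ D.T, w.1.valuation (D'.rho t) ≤ w.1.valuation (D'.rho D.s)) ∧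
        w.1.valuation (D'.rho D.s) ≠ 0 := fun w => by
    obtain ⟨h1, h2⟩ := hsub (D'.spaRho_mem_R w)
    exact ⟨fun t ht => (D'.spaRho_le w t D.s).1 (h1 t ht), (D'.spaRho_ne_zero w D.s).1 h2⟩
  -- Completeness of `A⟨T'/s'⟩` enters here: `r` is the inverse of `ρ'(s)`.
  obtain ⟨r, hr⟩ := (isUnit_of_forall_ne_zero hplus hnil fun w => (hR w).2).exists_right_inv
  have hfrac : ∀ t ∈ D.T, D'.rho t * r ∈ D'.plus Aplus := fun t ht => by
    refine mem_of_forall_le_one hplus hnil fun w => ?_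
    have h1 := congrArg w.1.valuation hr
    rw [map_mul, map_one] at h1
    rw [map_mul, ← h1]
    gcongr
    exact (hR w).1 t ht
  have huniq : ∀ σ τ : D.Completed →+* D'.Completed, Continuous σ ∧ σ.comp D.rho = D'.rho →
      Continuous τ ∧ τ.comp D.rho = D'.rho → σ = τ := fun σ τ hσ hτ =>
    D.ringHom_ext hσ.1 hτ.1 (hσ.2.trans hτ.2.symm)
  obtain ⟨σ, hσ⟩ := D.exists_continuous_lift D'.continuous_rho hr
    fun t ht => hplus.powerBounded _ (hfrac t ht)
  refine ⟨⟨σ, hσ, fun τ hτ => huniq τ σ hτ hσ⟩, fun τ hτ hτρ => ?_⟩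
  refine D.map_mem_of_mem_plus hplus (D'.rho_mem_plus Aplus) hτ hτρ fun t ht => ?_
  have hτρ' : ∀ a, τ (D.rho a) = D'.rho a := RingHom.congr_fun hτρ
  have hinv : τ D.rhoInv = r := by
    have h1 := congrArg τ D.rho_mul_rhoInv
    rw [map_mul, map_one, hτρ', ← hr] at h1
    exact (IsUnit.of_mul_eq_one _ hr).mul_left_cancel h1
  rw [coe_frac, map_mul, hτρ', hinv]
  exact hfrac t ht

/-! ### Correspondence of rational subsets -/

theorem spaRho_mem_R_iff (E : RationalDatum A) (w : Spa D.Completed (D.plus Aplus)) :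
    D.spaRho Aplus w ∈ E.R Aplus ↔ w ∈ (D.mapRho E).R (D.plus Aplus) := by
  refine and_congr ⟨fun h x hx => ?_, fun h t ht => ?_⟩ (D.spaRho_ne_zero w E.s)
  · obtain ⟨t, ht, rfl⟩ := D.mem_mapRho_T.1 hx
    exact (D.spaRho_le w t E.s).1 (h t ht)
  · exact (D.spaRho_le w t E.s).2 (h _ (D.mem_mapRho_T.2 ⟨t, ht, rfl⟩))

/-- A rational subset of `Spa A⟨T/s⟩` can be defined by elements of `A`. -/
theorem exists_spaRho_mem_iff (E : RationalDatum D.Completed) :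
    ∃ (F : Finset A) (g : A), ∃ U : Set A, U ∈ 𝓝 0 ∧
      (∀ w : Spa D.Completed (D.plus Aplus), w ∈ E.R (D.plus Aplus) ↔
        (∀ f ∈ F, w.1.valuation (D.rho f) ≤ w.1.valuation (D.rho g)) ∧
          w.1.valuation (D.rho g) ≠ 0) ∧
      ∀ w ∈ E.R (D.plus Aplus), ∀ u ∈ U,
        w.1.valuation (D.rho u) ≤ w.1.valuation (D.rho (D.s * g)) := by
  classical
  obtain ⟨U, hU⟩ := exists_openAddSubgroup_isTopologicallyNilpotent D.Completed
  have hG := (isOpen_mulSpan E U.isOpen).mem_nhds (zero_mem _)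
  -- Errors in `E.T · U` are harmless on `R(E)`, but not a priori at other points satisfying the
  -- approximated inequalities. The conditions `t ≤ g` for `t ∈ M.T` hold on `R(E)` since `M.T` maps
  -- into `E.T · U`, and elsewhere they bound errors lying in `M.T · U`. Hence the approximations
  -- `c` are taken modulo both neighbourhoods.
  obtain ⟨M, -, hM⟩ := exists_rationalDatum_subset (D.continuous_rho.continuousAt.preimage_mem_nhds
    (x := (0 : A)) (by rw [map_zero]; exact hG)) 0
  have hO := (isOpen_mulSpan (D.mapRho M) U.isOpen).mem_nhds (zero_mem _)
  have hGO := Filter.inter_mem hG hO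
  choose c hcG hcO using fun x : D.Completed => exists_coe_sub_mem hGO x
  choose n hn using fun x => D.exists_mul_pow_eq_rho (c x)
  let k := max (n E.s) (E.T.sup n)
  obtain ⟨g, hg⟩ := hn E.s k (le_max_left _ _)
  have hf : ∀ f, ∃ f', f ∈ E.T →
      (Completion.coeRingHom (c f) : D.Completed) * D.rho D.s ^ k = D.rho f' := fun f => by
    by_cases h : f ∈ E.T
    · obtain ⟨f', hf'⟩ := hn f k ((Finset.le_sup h).trans (le_max_right _ _))
      exact ⟨f', fun _ => hf'⟩
    · exact ⟨0, fun h' => absurd h' h⟩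
  choose φ hφ using hf
  have hltG : ∀ w ∈ E.R (D.plus Aplus),
      ∀ x ∈ mulSpan (E.T : Set D.Completed) (U : Set D.Completed),
        w.1.valuation x < w.1.valuation E.s := fun w hw x hx =>
    valuation_lt_of_mem_mulSpan hU hw.2 hw.1 hx
  have hgs : ∀ w ∈ E.R (D.plus Aplus),
      w.1.valuation (Completion.coeRingHom (c E.s)) = w.1.valuation E.s := fun w hw =>
    Valuation.map_eq_of_sub_lt _ (by rw [Valuation.map_sub_swap]; exact hltG w hw _ (hcG E.s))
  refine ⟨E.T.image φ ∪ M.T.image (· * D.s ^ k), g,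
    -- The exponent is `k + 1` because `ρ(s * g)` is the approximation of `E.s` times `ρ(s) ^ (k +
    -- 1)`.
    {u | D.rhoInv ^ (k + 1) * D.rho u ∈ mulSpan (E.T : Set D.Completed) (U : Set D.Completed)},
    ?_, fun w => ?_, fun w hw u hu => ?_⟩
  · exact ((continuous_const_mul (D.rhoInv ^ (k + 1))).comp
      D.continuous_rho).continuousAt.preimage_mem_nhds
        (by rw [Function.comp_apply, map_zero, mul_zero]; exact hG)
  · have hiff : ((∀ f ∈ E.T.image φ ∪ M.T.image (· * D.s ^ k),
        w.1.valuation (D.rho f) ≤ w.1.valuation (D.rho g)) ∧ w.1.valuation (D.rho g) ≠ 0) ↔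
        ((∀ f ∈ E.T, w.1.valuation (Completion.coeRingHom (c f)) ≤
            w.1.valuation (Completion.coeRingHom (c E.s))) ∧
          ∀ t ∈ M.T, w.1.valuation (D.rho t) ≤ w.1.valuation (Completion.coeRingHom (c E.s))) ∧
          w.1.valuation (Completion.coeRingHom (c E.s)) ≠ 0 := by
      simp only [Finset.forall_mem_union, Finset.forall_mem_image]
      rw [← hg, valuation_mul_rho_pow_ne_zero]
      refine and_congr_left fun _ => and_congr (forall₂_congr fun f h => ?_)
        (forall₂_congr fun t _ => ?_)
      · rw [← hφ f h, valuation_mul_rho_pow_le]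
      · rw [map_mul, map_pow, valuation_mul_rho_pow_le]
    rw [hiff]
    constructor
    · intro hw
      rw [hgs w hw]
      refine ⟨⟨fun f hf => ?_, fun t ht => (hltG w hw _ (hM ht)).le⟩, hw.2⟩
      rw [← sub_sub_cancel f (Completion.coeRingHom (c f))]
      exact (w.1.valuation.map_sub _ _).trans (max_le (hw.1 f hf) (hltG w hw _ (hcG f)).le)
    · rintro ⟨⟨hF, ht⟩, h0⟩
      have hlt : ∀ x ∈ mulSpan ((D.mapRho M).T : Set D.Completed) (U : Set D.Completed),
          w.1.valuation x < w.1.valuation (Completion.coeRingHom (c E.s)) := fun x hx =>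
        valuation_lt_of_mem_mulSpan hU h0 (by
          intro y hy
          obtain ⟨t, ht', rfl⟩ := D.mem_mapRho_T.1 hy
          exact ht t ht') hx
      have hs : w.1.valuation E.s = w.1.valuation (Completion.coeRingHom (c E.s)) :=
        Valuation.map_eq_of_sub_lt _ (hlt _ (hcO E.s))
      refine ⟨fun f hf => ?_, hs ▸ h0⟩
      rw [hs, ← sub_add_cancel f (Completion.coeRingHom (c f))]
      exact (w.1.valuation.map_add _ _).trans (max_le (hlt _ (hcO f)).le (hF f hf))
  · have h1 : D.rho u = (D.rhoInv ^ (k + 1) * D.rho u) * D.rho D.s ^ (k + 1) := by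
      rw [mul_right_comm, ← mul_pow, mul_comm D.rhoInv, rho_mul_rhoInv, one_pow, one_mul]
    have h2 : D.rho (D.s * g) = Completion.coeRingHom (c E.s) * D.rho D.s ^ (k + 1) := by
      rw [map_mul, ← hg, pow_succ]
      ring
    rw [h1, h2, valuation_mul_rho_pow_le, hgs w hw]
    exact (hltG w hw _ hu).le

/-- The conditions `f ≤ g` and `t ≤ s` are put over the common denominator `s * g`. The numerators
`s * f` and `t * g` need not generate an open ideal, so a finite set `L` is added that does; it is
small enough to impose no new condition on the image. -/
theorem isRationalSubset_image {V : Set (Spa D.Completed (D.plus Aplus))}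
    (hV : IsRationalSubset V) : IsRationalSubset (D.spaRho Aplus '' V) := by
  classical
  obtain ⟨E, rfl⟩ := hV
  obtain ⟨F, g, U, hU, hiff, hsmall⟩ := D.exists_spaRho_mem_iff (Aplus := Aplus) E
  obtain ⟨L, -, hL⟩ := exists_rationalDatum_subset hU 0
  refine ⟨⟨(F.image (D.s * ·) ∪ D.T.image (· * g)) ∪ L.T, D.s * g, ?_⟩, ?_⟩
  · refine AddSubgroup.isOpen_mono (H₁ := (Ideal.span (L.T : Set A)).toAddSubgroup)
      (H₂ := (Ideal.span (((F.image (D.s * ·) ∪ D.T.image (· * g)) ∪ L.T : Finset A) :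
        Set A)).toAddSubgroup) ?_ L.isOpen_span
    exact Ideal.span_mono (by rw [Finset.coe_union]; exact subset_union_right)
  · have hmem : ∀ x : Spa A Aplus, x.1.valuation D.s ≠ 0 → x.1.valuation g ≠ 0 →
        (((∀ t ∈ (F.image (D.s * ·) ∪ D.T.image (· * g)) ∪ L.T,
          x.1.valuation t ≤ x.1.valuation (D.s * g)) ∧ x.1.valuation (D.s * g) ≠ 0) ↔
        ((∀ f ∈ F, x.1.valuation f ≤ x.1.valuation g) ∧
          ∀ t ∈ D.T, x.1.valuation t ≤ x.1.valuation D.s) ∧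
          ∀ t ∈ L.T, x.1.valuation t ≤ x.1.valuation (D.s * g)) := by
      intro x hs hg
      have hne : x.1.valuation (D.s * g) ≠ 0 := by rw [map_mul]; exact mul_ne_zero hs hg
      rw [and_iff_left hne]
      simp only [Finset.forall_mem_union, Finset.forall_mem_image, map_mul,
        mul_le_mul_iff_right₀ (zero_lt_iff.2 hs), mul_le_mul_iff_left₀ (zero_lt_iff.2 hg)]
    ext x
    constructor
    · rintro ⟨w, hw, rfl⟩
      obtain ⟨hF, hg⟩ := (hiff w).1 hw
      obtain ⟨hT, hs⟩ := D.spaRho_mem_R w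
      refine (hmem _ hs ((D.spaRho_ne_zero w g).2 hg)).2 ⟨⟨fun f hf => ?_, hT⟩, fun t ht => ?_⟩
      · rw [spaRho_le]
        exact hF f hf
      · rw [spaRho_le]
        exact hsmall w hw t (hL ht)
    · intro hx
      have hne : x.1.valuation (D.s * g) ≠ 0 := hx.2
      rw [map_mul] at hne
      have hs := left_ne_zero_of_mul hne
      have hg := right_ne_zero_of_mul hne
      obtain ⟨⟨hF, hT⟩, -⟩ := (hmem x hs hg).1 hx
      obtain ⟨w, rfl⟩ := D.exists_spaRho_eq ⟨hT, hs⟩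
      refine ⟨w, (hiff w).2 ⟨fun f hf => ?_, (D.spaRho_ne_zero w g).1 hg⟩, rfl⟩
      rw [← spaRho_le]
      exact hF f hf

theorem bijOn_isRationalSubset :
    Set.BijOn (fun V : Set (Spa D.Completed (D.plus Aplus)) => D.spaRho Aplus '' V)
      {V | IsRationalSubset V} {W | IsRationalSubset W ∧ W ⊆ D.R Aplus} := by
  refine ⟨fun V hV => ⟨D.isRationalSubset_image hV, ?_⟩,
    D.isEmbedding_spaRho.injective.image_injective.injOn, ?_⟩
  · rw [← range_spaRho]
    exact Set.image_subset_range _ _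
  · rintro W ⟨⟨E, rfl⟩, hsub⟩
    refine ⟨(D.mapRho E).R (D.plus Aplus), ⟨_, rfl⟩, ?_⟩
    have : (D.mapRho E).R (D.plus Aplus) = D.spaRho Aplus ⁻¹' E.R Aplus :=
      Set.ext fun w => (D.spaRho_mem_R_iff E w).symm
    dsimp only
    rw [this, Set.image_preimage_eq_inter_range, range_spaRho, Set.inter_eq_left]
    exact hsub

end RationalDatum

end AdicSpectrum

theorem mainTheorem6 {A : Type*} [CommRing A] [TopologicalSpace A] [AdicSpectrum.FAdicRing A]
    (Aplus : Subring A) (hA : AdicSpectrum.IsRingOfIntegralElements Aplus) :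
    (∀ D D' : AdicSpectrum.RationalDatum A, D'.R Aplus ⊆ D.R Aplus →
      (∃! σ : D.Completed →+* D'.Completed, Continuous σ ∧ σ.comp D.rho = D'.rho) ∧
      ∀ σ : D.Completed →+* D'.Completed, Continuous σ → σ.comp D.rho = D'.rho →
        ∀ b ∈ D.plus Aplus, σ b ∈ D'.plus Aplus) ∧
    (∀ D : AdicSpectrum.RationalDatum A,
      (∃ h : AdicSpectrum.Spa D.Completed (D.plus Aplus) ≃ₜ D.R Aplus,
        ∀ x, (h x : AdicSpectrum.Spa A Aplus) = D.spaRho Aplus x) ∧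
      Set.BijOn (fun V : Set (AdicSpectrum.Spa D.Completed (D.plus Aplus)) =>
          D.spaRho Aplus '' V)
        {V | AdicSpectrum.IsRationalSubset V}
        {W | AdicSpectrum.IsRationalSubset W ∧ W ⊆ D.R Aplus}) := by
  refine ⟨fun D D' h => D.rational_restriction hA h, fun D => ⟨?_, D.bijOn_isRationalSubset⟩⟩
  exact ⟨D.isEmbedding_spaRho.toHomeomorph.trans (Homeomorph.setCongr D.range_spaRho),
    fun _ => rfl⟩
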